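/- For $k\ge 1$, call a function $g:(0,1]^k\to(0,1]$ that is non-decreasing in each argument a hierarchy bound, and write $a\ll b_1,\dots,b_k$ (for a given $g$) to mean $a\le g(b_1,\dots,b_k)$. For a graph $G$ and disjoint non-empty $A,B\subseteq V(G)$ let $d_G(A,B)=e_G(A,B)/(|A||B|)$. The graph $G$ is $(\gamma,p)$-pseudorandom if $|d_G(A,B)-p|\le\gamma p$ for all disjoint non-empty $A,B\subseteq V(G)$ with $|A|,|B|\ge\gamma|V(G)|$. A subgraph $H$ of $G$ is $\alpha$-residual if $d_H(v)\ge\alpha\, d_{G[V(H)]}(v)$ for every $v\in V(H)$, and spanning if $V(H)=V(G)$. A linear forest is a forest each of whose connected components is a path (a single vertex counts as a path). An $r$-edge-colouring is an arbitrary assignment of one of $r$ colours to each edge. Theorem. There are hierarchy bounds $g_1,g_2:(0,1]^3\to(0,1]$ and $g_3:(0,1]^2\to(0,1]$ such that the following holds. Let $r\ge1$ be an integer, $\alpha,\varepsilon\in(0,1]$, let $C,\gamma>0$ be real numbers with $\frac1C\le g_1(\alpha,\varepsilon,\frac1r)$ and $\gamma\le g_2(\alpha,\varepsilon,\frac1r)$,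 and let $n\ge 1$ be an integer with $\frac1n\le g_3(\frac1C,\gamma)$ (in short: $0<\frac1n\ll\frac1C,\gamma\ll\alpha,\varepsilon,\frac1r\le1$). Let $p\in(0,1]$, let $G$ be an $n$-vertex $(\gamma,p)$-pseudorandom graph, and let $H$ be an $\alpha$-residual spanning subgraph of $G$. Then for every $r$-edge-colouring of $H$ there is a monochromatic linear forest in $H$ that consists of at most $C$ paths and has at least $$(1-\varepsilon)\min\left\{\frac{2\alpha n}{r},\ \frac{2n}{r+1}\right\}$$ edges. -/

import Mathlib

/-- An admissible bound in a hierarchy `a ≪ b₁, …, b_k`: a function `(0,1]^k → (0,1]` that is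
non-decreasing in each argument. The relation `a ≪ b₁, …, b_k` then means `a ≤ g ![b₁, …, b_k]`.
Only the values of `g` on `(0,1]^k` matter. -/
def IsHierarchyBound {k : ℕ} (g : (Fin k → ℝ) → ℝ) : Prop :=
  MonotoneOn g {x | ∀ i, x i ∈ Set.Ioc (0 : ℝ) 1} ∧
    Set.MapsTo g {x | ∀ i, x i ∈ Set.Ioc (0 : ℝ) 1} (Set.Ioc 0 1)

open Classical in
/-- `G` is `(γ, p)`-pseudorandom: any two disjoint non-empty vertex sets, each of size at least
`γ |V(G)|`, have density `(1 ± γ) p`. -/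
def IsPseudorandom {V : Type*} [Fintype V] (G : SimpleGraph V) (γ p : ℝ) : Prop :=
  ∀ A B : Finset V, Disjoint A B → A.Nonempty → B.Nonempty →
    γ * (Fintype.card V : ℝ) ≤ (A.card : ℝ) → γ * (Fintype.card V : ℝ) ≤ (B.card : ℝ) →
      |(G.edgeDensity A B : ℝ) - p| ≤ γ * p

/-- `H` is an `α`-residual subgraph of `G`: `d_H(v) ≥ α d_{G[V(H)]}(v)` for all `v ∈ V(H)`. -/
def IsResidual {V : Type*} {G : SimpleGraph V} (α : ℝ) (H : G.Subgraph) : Prop :=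
  ∀ v ∈ H.verts,
    α * ((G.neighborSet v ∩ H.verts).ncard : ℝ) ≤ ((H.neighborSet v).ncard : ℝ)

/-- A linear forest: a forest each of whose connected components is a path
(a single vertex counts as a path). -/
def IsLinearForest {V : Type*} (F : SimpleGraph V) : Prop :=
  F.IsAcyclic ∧
    ∀ K : F.ConnectedComponent, ∃ m : ℕ, Nonempty (K.toSimpleGraph ≃g SimpleGraph.pathGraph m)

/-! ### Disjoint paths as linear forests -/

section LinearForest

variable {ι W V : Type*} {L : ι → ℕ}

/-! Let `m` be the minimum in the theorem and `M = (1 - ε/2) m`. A half-integral cover puts value 1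
on `A` and 1/2 on `B`, so `2|A| + |B|` is twice its weight. The core is an approximate duality for
each colour class (`exists_cover_or_paths`): either some half-integral cover with `2|A| + |B| ≤ M`
misses only a small multiple of `pn²` edges, or boundedly many disjoint paths have nearly `M` edges
in total.

For the duality, suppose that every such cover misses many edges. Any vertex weighting, scaled to a
fractional cover and rounded at a threshold, leaves a dense pair whose edges all have light ends
(`exists_light_dense_pair`). Density increments, capped by pseudorandomness, find inside it a
linear-sized pair with an edge between any two sizeable subsets (`exists_isFullPair`). Light full
pairs thus exist for all weightings, and multiplicative weights turn them into a fractional packing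
of boundedly many full pairs of total size near `M`, with little overload
(`exists_fractional_packing`). Overlaps are split into disjoint shares (`exists_disjoint_shares`),
and depth first search nearly exhausts each share by one path (`exists_path_of_card_eq`).

If no colour has such paths, every colour `i` has a cover `(A i, B i)`. Let `U₀` be the union of the
`A i`. A typical vertex outside `U₀` sends nearly all its `H`-edges into `U₀` and the `B i`
containing it. If it lies in only one `B i`, residuality and pseudorandomness force `|U₀ ∪ B i|` to
be at least about `αn`; if in none, the same holds for `U₀`. As `rM < 2αn`, the latter is impossible
and the former can happen for at most one index `i₀`. So almost every vertex lies in `U₀`, in `B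
i₀`, or in two other sets `B j`. Counting gives roughly `n ≤ (r+1)M/2`, contrary to the choice of
`M` (`not_small_covers`). -/

theorem SimpleGraph.not_reachable_of_closed {G : SimpleGraph V} {S : Set V}
    (hS : ∀ x y, G.Adj x y → x ∈ S → y ∈ S) {u v : V} (hu : u ∈ S) (hv : v ∉ S) :
    ¬ G.Reachable u v := by
  rintro ⟨p⟩
  induction p with
  | nil => exact hv hu
  | cons h p ih => exact ih (hS _ _ h hu) hv

/-- The vertex-disjoint union of the paths `pathGraph (L i)`. -/
def SigmaPathAdj (x y : Σ i, Fin (L i)) : Prop :=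
  x.1 = y.1 ∧ (x.2.val + 1 = y.2.val ∨ y.2.val + 1 = x.2.val)

theorem reachable_of_sigmaPathAdj {F : SimpleGraph W} (g : (Σ i, Fin (L i)) → W)
    (hg : ∀ x y, SigmaPathAdj x y → F.Adj (g x) (g y)) (i : ι) (a b : Fin (L i)) :
    F.Reachable (g ⟨i, a⟩) (g ⟨i, b⟩) := by
  have h := SimpleGraph.pathGraph_preconnected (L i) a b
  refine h.map (⟨fun c => g ⟨i, c⟩, ?_⟩ : SimpleGraph.pathGraph (L i) →g F)
  intro c d hcd
  rw [SimpleGraph.pathGraph_adj] at hcd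
  exact hg _ _ ⟨rfl, hcd⟩

theorem fst_eq_of_reachable {F : SimpleGraph W} (g : (Σ i, Fin (L i)) ≃ W)
    (hg : ∀ x y, F.Adj (g x) (g y) ↔ SigmaPathAdj x y) {x y : Σ i, Fin (L i)}
    (h : F.Reachable (g x) (g y)) : x.1 = y.1 := by
  by_contra hne
  refine SimpleGraph.not_reachable_of_closed (S := {w | (g.symm w).1 = x.1}) ?_ (by simp)
    (by simpa using Ne.symm hne) h
  intro u v huv hu
  have := (hg (g.symm u) (g.symm v)).1 (by simpa using huv)
  exact this.1.symm.trans hu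

/-- Every edge is a bridge: once it is deleted, the initial segment of its path up to that edge is
closed under adjacency. -/
theorem isAcyclic_of_sigmaPathAdj {F : SimpleGraph W} (g : (Σ i, Fin (L i)) ≃ W)
    (hg : ∀ x y, F.Adj (g x) (g y) ↔ SigmaPathAdj x y) : F.IsAcyclic := by
  rw [SimpleGraph.isAcyclic_iff_forall_adj_isBridge]
  have key : ∀ x y : Σ i, Fin (L i), x.1 = y.1 → x.2.val + 1 = y.2.val →
      ¬ (F.deleteEdges {s(g x, g y)}).Reachable (g x) (g y) := by
    intro x y hxy hval
    refine SimpleGraph.not_reachable_of_closed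
      (S := {w | ∃ z, g z = w ∧ z.1 = x.1 ∧ z.2.val ≤ x.2.val}) ?_ ⟨x, rfl, rfl, le_rfl⟩ ?_
    swap
    · rintro ⟨z, hz, -, h⟩
      obtain rfl := g.injective hz
      omega
    rintro _ v huv ⟨u, rfl, hu⟩
    obtain ⟨v, rfl⟩ := g.surjective v
    simp only [SimpleGraph.deleteEdges_adj, Set.mem_singleton_iff, hg] at huv
    obtain ⟨⟨h1, h2⟩, h3⟩ := huv
    refine ⟨v, rfl, h1.symm.trans hu.1, ?_⟩
    by_contra hlt
    apply h3
    obtain ⟨xi, xa⟩ := x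
    obtain ⟨yi, ya⟩ := y
    obtain ⟨ui, ua⟩ := u
    obtain ⟨vi, va⟩ := v
    simp only at *
    subst hxy
    obtain ⟨hu1, hu2⟩ := hu
    subst hu1
    subst h1
    have e1 : ua = xa := Fin.ext (by omega)
    have e2 : va = ya := Fin.ext (by omega)
    rw [e1, e2]
  intro u v huv
  obtain ⟨x, rfl⟩ := g.surjective u
  obtain ⟨y, rfl⟩ := g.surjective v
  obtain ⟨h1, h2 | h2⟩ := (hg x y).1 huv
  · rw [SimpleGraph.isBridge_iff]
    exact key x y h1 h2
  · rw [SimpleGraph.isBridge_iff]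
    have := key y x h1.symm h2
    rw [Sym2.eq_swap] at this
    exact fun h => this h.symm

theorem isLinearForest_of_sigmaPathAdj {F : SimpleGraph W} (g : (Σ i, Fin (L i)) ≃ W)
    (hg : ∀ x y, F.Adj (g x) (g y) ↔ SigmaPathAdj x y) : IsLinearForest F := by
  refine ⟨isAcyclic_of_sigmaPathAdj g hg, fun K => ?_⟩
  obtain ⟨w, rfl⟩ := K.exists_rep
  obtain ⟨⟨i, a⟩, rfl⟩ := g.surjective w
  refine ⟨L i, ⟨SimpleGraph.Iso.symm ⟨Equiv.ofBijective (fun b => ⟨g ⟨i, b⟩, ?_⟩) ⟨?_, ?_⟩, ?_⟩⟩⟩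
  · exact SimpleGraph.ConnectedComponent.sound
      (reachable_of_sigmaPathAdj g (fun x y h => (hg x y).2 h) i b a)
  · intro b c hbc
    have := g.injective (Subtype.ext_iff.1 hbc)
    simpa using this
  · rintro ⟨w, hw⟩
    obtain ⟨⟨j, b⟩, rfl⟩ := g.surjective w
    have : j = i := fst_eq_of_reachable g hg (SimpleGraph.ConnectedComponent.exact hw)
    subst this
    exact ⟨b, rfl⟩
  · intro b c
    change F.Adj (g ⟨i, b⟩) (g ⟨i, c⟩) ↔ _
    rw [hg, SimpleGraph.pathGraph_adj]
    simp [SigmaPathAdj]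

theorem card_connectedComponent_le_of_sigmaPathAdj [Finite ι] {F : SimpleGraph W}
    (g : (Σ i, Fin (L i)) ≃ W) (hg : ∀ x y, F.Adj (g x) (g y) ↔ SigmaPathAdj x y) :
    Nat.card F.ConnectedComponent ≤ Nat.card ι := by
  refine Nat.card_le_card_of_injective (fun K => (g.symm K.out).1) ?_
  intro K K' h
  have hr := reachable_of_sigmaPathAdj (F := F) g (fun x y h => (hg x y).2 h)
  have h1 : F.Reachable (g (g.symm K.out)) (g (g.symm K'.out)) := by
    have h : (g.symm K.out).1 = (g.symm K'.out).1 := h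
    generalize g.symm K.out = x at *
    generalize g.symm K'.out = y at *
    obtain ⟨xi, xa⟩ := x
    obtain ⟨yi, ya⟩ := y
    obtain rfl : xi = yi := h
    exact hr _ _ _
  simp only [Equiv.apply_symm_apply] at h1
  rw [← Quot.out_eq K, ← Quot.out_eq K']
  exact SimpleGraph.ConnectedComponent.sound h1

/-- Vertex-disjoint paths in `H`, given by an injective parametrisation, form a linear forest. -/
theorem exists_linearForest_subgraph [Fintype ι] [Finite V] {G : SimpleGraph V} (H : G.Subgraph)
    (P : V → V → Prop) (f : (Σ i, Fin (L i)) → V) (hf : Function.Injective f)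
    (hv : ∀ x, f x ∈ H.verts) (hsymm : ∀ u v, P u v → P v u)
    (hP : ∀ i (a b : Fin (L i)), a.val + 1 = b.val →
      H.Adj (f ⟨i, a⟩) (f ⟨i, b⟩) ∧ P (f ⟨i, a⟩) (f ⟨i, b⟩)) :
    ∃ F : G.Subgraph, F ≤ H ∧ IsLinearForest F.coe ∧ (∀ u v, F.Adj u v → P u v) ∧
      ∑ i, (L i - 1) ≤ F.edgeSet.ncard ∧ Nat.card F.coe.ConnectedComponent ≤ Fintype.card ι := by
  have hadj : ∀ x y, SigmaPathAdj x y → H.Adj (f x) (f y) ∧ P (f x) (f y) := by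
    rintro ⟨i, a⟩ ⟨j, b⟩ ⟨hij, h⟩
    obtain rfl : i = j := hij
    rcases h with h | h
    · exact hP i a b h
    · exact ⟨(hP i b a h).1.symm, hsymm _ _ (hP i b a h).2⟩
  let F : G.Subgraph :=
    { verts := Set.range f
      Adj := fun u v => ∃ x y, SigmaPathAdj x y ∧ f x = u ∧ f y = v
      adj_sub := by
        rintro _ _ ⟨x, y, h, rfl, rfl⟩
        exact (hadj x y h).1.adj_sub
      edge_vert := by
        rintro _ _ ⟨x, y, h, rfl, rfl⟩
        exact ⟨x, rfl⟩
      symm := ⟨by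
        rintro _ _ ⟨x, y, h, rfl, rfl⟩
        exact ⟨y, x, ⟨h.1.symm, h.2.symm⟩, rfl, rfl⟩⟩ }
  let g : (Σ i, Fin (L i)) ≃ F.verts := Equiv.ofInjective f hf
  have hg : ∀ x y, F.coe.Adj (g x) (g y) ↔ SigmaPathAdj x y := by
    intro x y
    constructor
    · rintro ⟨x', y', h, h1, h2⟩
      rwa [hf h1, hf h2] at h
    · intro h
      exact ⟨x, y, h, rfl, rfl⟩
  refine ⟨F, ⟨?_, ?_⟩, isLinearForest_of_sigmaPathAdj g hg, ?_, ?_, ?_⟩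
  · rintro _ ⟨x, rfl⟩
    exact hv x
  · rintro _ _ ⟨x, y, h, rfl, rfl⟩
    exact (hadj x y h).1
  · rintro _ _ ⟨x, y, h, rfl, rfl⟩
    exact (hadj x y h).2
  · let φ : (Σ i, Fin (L i - 1)) → Sym2 V := fun x =>
      s(f ⟨x.1, ⟨x.2.val, by have := x.2.isLt; omega⟩⟩,
        f ⟨x.1, ⟨x.2.val + 1, by have := x.2.isLt; omega⟩⟩)
    have hφ : Function.Injective φ := by
      rintro ⟨i, a⟩ ⟨j, b⟩ h
      simp only [φ, Sym2.eq_iff] at h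
      rcases h with ⟨h, -⟩ | ⟨h1, h2⟩
      · have := hf h
        simp only [Sigma.mk.injEq] at this
        obtain ⟨rfl, h⟩ := this
        simpa [Fin.ext_iff] using h
      -- Two edges matched in opposite directions would need `a = b + 1` and `a + 1 = b`.
      · have h1 := hf h1
        have h2 := hf h2
        simp only [Sigma.mk.injEq] at h1 h2
        obtain ⟨rfl, h1⟩ := h1
        obtain ⟨-, h2⟩ := h2
        simp only [heq_eq_eq, Fin.mk.injEq] at h1 h2
        omega
    have hsub : Set.range φ ⊆ F.edgeSet := by
      rintro _ ⟨x, rfl⟩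
      simp only [φ, SimpleGraph.Subgraph.mem_edgeSet]
      exact ⟨⟨x.1, ⟨x.2.val, by have := x.2.isLt; omega⟩⟩,
        ⟨x.1, ⟨x.2.val + 1, by have := x.2.isLt; omega⟩⟩, ⟨rfl, Or.inl rfl⟩, rfl, rfl⟩
    have h1 : (Set.range φ).ncard = ∑ i, (L i - 1) := by
      rw [← Set.image_univ, Set.ncard_image_of_injective _ hφ, Set.ncard_univ,
        Nat.card_eq_fintype_card]
      simp
    rw [← h1]
    exact Set.ncard_le_ncard hsub (Set.toFinite _)
  · rw [← Nat.card_eq_fintype_card]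
    exact card_connectedComponent_le_of_sigmaPathAdj g hg

end LinearForest

/-! ### Edge counts, averaging and cuts -/

section EdgeCount

open Classical

variable {V : Type*}

/-- The number of ordered pairs in `X × Y` that are adjacent in `F`. -/
noncomputable def edgeCount (F : SimpleGraph V) (X Y : Finset V) : ℝ :=
  ∑ x ∈ X, ∑ y ∈ Y, if F.Adj x y then (1 : ℝ) else 0

theorem edgeCount_nonneg (F : SimpleGraph V) (X Y : Finset V) : 0 ≤ edgeCount F X Y :=
  Finset.sum_nonneg fun _ _ => Finset.sum_nonneg fun _ _ => by split_ifs <;> norm_num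

theorem edgeCount_comm (F : SimpleGraph V) (X Y : Finset V) :
    edgeCount F X Y = edgeCount F Y X := by
  unfold edgeCount
  rw [Finset.sum_comm]
  simp_rw [F.adj_comm]

theorem edgeCount_mono {F F' : SimpleGraph V} (h : F ≤ F') {X X' Y Y' : Finset V} (hX : X ⊆ X')
    (hY : Y ⊆ Y') : edgeCount F X Y ≤ edgeCount F' X' Y' := by
  have h1 : ∀ x, ∑ y ∈ Y, (if F.Adj x y then (1 : ℝ) else 0) ≤
      ∑ y ∈ Y', if F'.Adj x y then (1 : ℝ) else 0 := by
    intro x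
    refine (Finset.sum_le_sum fun y _ => ?_).trans
      (Finset.sum_le_sum_of_subset_of_nonneg hY fun y _ _ => by split_ifs <;> norm_num)
    by_cases hF : F.Adj x y
    · simp [hF, h hF]
    · simp only [hF, if_false]
      split_ifs <;> norm_num
  exact (Finset.sum_le_sum fun x _ => h1 x).trans
    (Finset.sum_le_sum_of_subset_of_nonneg hX fun x _ _ =>
      Finset.sum_nonneg fun y _ => by split_ifs <;> norm_num)

theorem edgeCount_union_left (F : SimpleGraph V) {X X' : Finset V} (h : Disjoint X X')
    (Y : Finset V) : edgeCount F (X ∪ X') Y = edgeCount F X Y + edgeCount F X' Y :=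
  Finset.sum_union h

theorem edgeCount_union_right (F : SimpleGraph V) (X : Finset V) {Y Y' : Finset V}
    (h : Disjoint Y Y') : edgeCount F X (Y ∪ Y') = edgeCount F X Y + edgeCount F X Y' := by
  rw [edgeCount_comm, edgeCount_union_left F h, edgeCount_comm, edgeCount_comm F Y']

theorem edgeCount_sdiff_left (F : SimpleGraph V) {X X' : Finset V} (h : X' ⊆ X) (Y : Finset V) :
    edgeCount F X Y = edgeCount F (X \ X') Y + edgeCount F X' Y := by
  rw [← edgeCount_union_left F Finset.sdiff_disjoint, Finset.sdiff_union_of_subset h]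

theorem edgeCount_sdiff_right (F : SimpleGraph V) (X : Finset V) {Y Y' : Finset V} (h : Y' ⊆ Y) :
    edgeCount F X Y = edgeCount F X (Y \ Y') + edgeCount F X Y' := by
  rw [← edgeCount_union_right F _ Finset.sdiff_disjoint, Finset.sdiff_union_of_subset h]

theorem edgeCount_eq_zero {F : SimpleGraph V} {X Y : Finset V}
    (h : ∀ x ∈ X, ∀ y ∈ Y, ¬ F.Adj x y) : edgeCount F X Y = 0 :=
  Finset.sum_eq_zero fun x hx => Finset.sum_eq_zero fun y hy => if_neg (h x hx y hy)

theorem edgeCount_eq_edgeDensity_mul (F : SimpleGraph V) {X Y : Finset V} (hX : X.Nonempty)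
    (hY : Y.Nonempty) : edgeCount F X Y = (F.edgeDensity X Y : ℝ) * (X.card * Y.card) := by
  have h1 : edgeCount F X Y = ((F.interedges X Y).card : ℝ) := by
    unfold edgeCount SimpleGraph.interedges Rel.interedges
    rw [Finset.card_filter, Finset.sum_product]
    push_cast
    rfl
  have hx : (X.card : ℝ) ≠ 0 := by exact_mod_cast hX.card_pos.ne'
  have hy : (Y.card : ℝ) ≠ 0 := by exact_mod_cast hY.card_pos.ne'
  rw [h1, SimpleGraph.edgeDensity_def]
  push_cast
  field_simp

/-- Discarding a smallest value never lowers the average. -/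
theorem Finset.exists_subset_card_eq_mul_sum_le (f : V → ℝ) (k : ℕ) (s : Finset V)
    (hk : k ≤ s.card) :
    ∃ t ⊆ s, t.card = k ∧ (k : ℝ) * ∑ x ∈ s, f x ≤ s.card * ∑ x ∈ t, f x := by
  rcases Nat.eq_zero_or_pos k with rfl | hk0
  · exact ⟨∅, by simp, rfl, by simp⟩
  induction s using Finset.strongInduction with
  | H s ih =>
    rcases hk.eq_or_lt with h | h
    · exact ⟨s, subset_rfl, h.symm, by rw [h]⟩
    obtain ⟨a, ha, hmin⟩ := s.exists_min_image f (Finset.card_pos.1 (by omega))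
    have hc : (s.erase a).card + 1 = s.card := Finset.card_erase_add_one ha
    obtain ⟨t, hts, htc, ht⟩ := ih (s.erase a) (Finset.erase_ssubset ha) (by omega)
    refine ⟨t, hts.trans (Finset.erase_subset _ _), htc, ?_⟩
    have hsum : ∑ x ∈ s.erase a, f x + f a = ∑ x ∈ s, f x := Finset.sum_erase_add _ _ ha
    have hav : (s.card : ℝ) * f a ≤ ∑ x ∈ s, f x := by
      simpa using Finset.card_nsmul_le_sum s f (f a) hmin
    have hc' : ((s.erase a).card : ℝ) + 1 = s.card := by exact_mod_cast hc
    have hpos : (0 : ℝ) < (s.erase a).card := by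
      have : 0 < (s.erase a).card := by omega
      exact_mod_cast this
    have hkr : (0 : ℝ) < k := by exact_mod_cast hk0
    rw [← hc'] at hav ⊢
    refine le_of_mul_le_mul_left ?_ hpos
    set m : ℝ := ((s.erase a).card : ℝ)
    have h1 : m * ∑ x ∈ s, f x ≤ (m + 1) * ∑ x ∈ s.erase a, f x := by
      rw [← hsum] at hav ⊢
      nlinarith
    calc m * (k * ∑ x ∈ s, f x) = k * (m * ∑ x ∈ s, f x) := by ring
      _ ≤ k * ((m + 1) * ∑ x ∈ s.erase a, f x) := by gcongr
      _ = (m + 1) * (k * ∑ x ∈ s.erase a, f x) := by ring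
      _ ≤ (m + 1) * (m * ∑ x ∈ t, f x) := by gcongr
      _ = _ := by ring

theorem exists_subset_left_edgeCount (F : SimpleGraph V) (X Y : Finset V) {k : ℕ}
    (hk : k ≤ X.card) :
    ∃ X' ⊆ X, X'.card = k ∧ (k : ℝ) * edgeCount F X Y ≤ X.card * edgeCount F X' Y :=
  Finset.exists_subset_card_eq_mul_sum_le _ k X hk

theorem exists_subset_right_edgeCount (F : SimpleGraph V) (X Y : Finset V) {k : ℕ}
    (hk : k ≤ Y.card) :
    ∃ Y' ⊆ Y, Y'.card = k ∧ (k : ℝ) * edgeCount F X Y ≤ Y.card * edgeCount F X Y' := by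
  obtain ⟨Y', h⟩ := exists_subset_left_edgeCount F Y X hk
  exact ⟨Y', by simpa only [edgeCount_comm F _ X] using h⟩

/-- Greedy max-cut: each new vertex joins the side to which it sends less weight. Half the weight
crosses, and ordered pairs cost another factor 2. -/
theorem Finset.exists_large_cut (f : V → V → ℝ) (hsymm : ∀ x y, f x y = f y x)
    (hdiag : ∀ x, f x x = 0) (U : Finset V) :
    ∃ S ⊆ U, ∑ x ∈ U, ∑ y ∈ U, f x y ≤ 4 * ∑ x ∈ S, ∑ y ∈ U \ S, f x y := by
  induction U using Finset.induction_on with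
  | empty => exact ⟨∅, by simp, by simp⟩
  | insert a U ha ih =>
    obtain ⟨S, hS, h⟩ := ih
    have haS : a ∉ S := fun h => ha (hS h)
    have htot : ∑ x ∈ insert a U, ∑ y ∈ insert a U, f x y =
        ∑ x ∈ U, ∑ y ∈ U, f x y + 2 * ∑ y ∈ U, f a y := by
      simp only [Finset.sum_insert ha, hdiag, Finset.sum_add_distrib]
      simp only [hsymm _ a]
      ring
    have hsplit : ∑ y ∈ U, f a y = ∑ y ∈ U \ S, f a y + ∑ y ∈ S, f a y :=
      (Finset.sum_sdiff hS).symm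
    rcases le_total (∑ y ∈ S, f a y) (∑ y ∈ U \ S, f a y) with hle | hle
    · refine ⟨insert a S, Finset.insert_subset_insert _ hS, ?_⟩
      have : insert a U \ insert a S = U \ S := by
        ext x
        simp only [Finset.mem_sdiff, Finset.mem_insert]
        by_cases hx : x = a
        · subst hx; simp [ha]
        · simp [hx]
      rw [this, Finset.sum_insert haS, htot]
      linarith
    · refine ⟨S, hS.trans (Finset.subset_insert _ _), ?_⟩
      have : insert a U \ S = insert a (U \ S) := Finset.insert_sdiff_of_notMem _ haS
      have ha' : a ∉ U \ S := by simp [ha]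
      simp only [this, Finset.sum_insert ha', Finset.sum_add_distrib, hsymm _ a]
      rw [htot]
      linarith

/-- A large cut of the symmetrised `X`-to-`Y` edges loses a factor 2, and choosing the better
direction across it loses another. -/
theorem exists_disjoint_subsets_edgeCount [Fintype V] (F : SimpleGraph V) (X Y : Finset V) :
    ∃ X' ⊆ X, ∃ Y' ⊆ Y, Disjoint X' Y' ∧ edgeCount F X Y ≤ 4 * edgeCount F X' Y' := by
  let R : V → V → ℝ := fun x y => if x ∈ X then (if y ∈ Y then
    (if F.Adj x y then 1 else 0) else 0) else 0
  have hR : ∀ A B : Finset V, ∑ x ∈ A, ∑ y ∈ B, R x y = edgeCount F (A ∩ X) (B ∩ Y) := by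
    intro A B
    unfold edgeCount
    rw [← Finset.sum_ite_mem]
    refine Finset.sum_congr rfl fun x _ => ?_
    by_cases hx : x ∈ X
    · simp only [R, hx, if_true, ← Finset.sum_ite_mem]
    · simp [R, hx]
  obtain ⟨S, -, hS⟩ := Finset.exists_large_cut (fun x y => R x y + R y x)
    (fun x y => add_comm _ _) (fun x => by simp [R]) Finset.univ
  have hsw : ∀ A B : Finset V, ∑ x ∈ A, ∑ y ∈ B, R y x = edgeCount F (B ∩ X) (A ∩ Y) := by
    intro A B
    rw [Finset.sum_comm, hR]
  simp only [Finset.sum_add_distrib, hR, hsw, Finset.univ_inter] at hS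
  rcases le_total (edgeCount F ((Finset.univ \ S) ∩ X) (S ∩ Y))
    (edgeCount F (S ∩ X) ((Finset.univ \ S) ∩ Y)) with h | h
  · exact ⟨S ∩ X, Finset.inter_subset_right, (Finset.univ \ S) ∩ Y, Finset.inter_subset_right,
      Finset.disjoint_sdiff.mono Finset.inter_subset_left Finset.inter_subset_left, by linarith⟩
  · exact ⟨(Finset.univ \ S) ∩ X, Finset.inter_subset_right, S ∩ Y, Finset.inter_subset_right,
      Finset.sdiff_disjoint.mono Finset.inter_subset_left Finset.inter_subset_left, by linarith⟩

end EdgeCount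

/-! ### Upper bounds on edge counts in pseudorandom graphs -/

section Pseudorandom

open Classical

variable {V : Type*} [Fintype V] {G : SimpleGraph V} {γ p : ℝ}

theorem IsPseudorandom.abs_edgeCount_sub_le (hG : IsPseudorandom G γ p) {X Y : Finset V}
    (hXY : Disjoint X Y) (hX0 : X.Nonempty) (hY0 : Y.Nonempty)
    (hX : γ * Fintype.card V ≤ X.card) (hY : γ * Fintype.card V ≤ Y.card) :
    |edgeCount G X Y - p * (X.card * Y.card)| ≤ γ * p * (X.card * Y.card) := by
  have h := hG X Y hXY hX0 hY0 hX hY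
  rw [edgeCount_eq_edgeDensity_mul G hX0 hY0, ← sub_mul, abs_mul,
    abs_of_nonneg (by positivity : (0 : ℝ) ≤ (X.card : ℝ) * Y.card)]
  exact mul_le_mul_of_nonneg_right h (by positivity)

/-- Small sets are padded to disjoint sets of sizes exactly `a` and `b`, to which pseudorandomness
applies. -/
theorem IsPseudorandom.edgeCount_le_of_card_le (hG : IsPseudorandom G γ p)
    {X Y : Finset V} (hXY : Disjoint X Y) {g a b : ℕ} (hg : γ * Fintype.card V ≤ g) (hg0 : 0 < g)
    (hX : X.card ≤ a) (hY : Y.card ≤ b) (hga : g ≤ a) (hgb : g ≤ b)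
    (hab : a + b ≤ Fintype.card V) : edgeCount G X Y ≤ (1 + γ) * p * (a * b) := by
  obtain ⟨X', hX', hX'Y, hX'a⟩ := Finset.exists_subsuperset_card_eq (s := X) (t := Yᶜ) (n := a)
    (by rwa [Finset.subset_compl_iff_disjoint_right]) hX (by rw [Finset.card_compl]; omega)
  obtain ⟨Y', hY', hY'X, hY'b⟩ := Finset.exists_subsuperset_card_eq (s := Y) (t := X'ᶜ) (n := b)
    (by rw [Finset.subset_compl_comm]; exact hX'Y) hY (by rw [Finset.card_compl]; omega)
  have h := hG.abs_edgeCount_sub_le (X := X') (Y := Y')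
    (by rw [Finset.subset_compl_iff_disjoint_right] at hY'X; exact hY'X.symm)
    (Finset.card_pos.1 (by omega)) (Finset.card_pos.1 (by omega))
    (hg.trans (by rw [hX'a]; exact_mod_cast hga)) (hg.trans (by rw [hY'b]; exact_mod_cast hgb))
  rw [hX'a, hY'b] at h
  have h1 := (abs_le.1 h).2
  have h2 := edgeCount_mono (le_refl G) hX' hY'
  linarith

/-- The constant is `4 * 4 * 2`: passing to disjoint sets, halving both so that there is room for
padding, and `1 + γ ≤ 2`. -/
theorem IsPseudorandom.edgeCount_le (hG : IsPseudorandom G γ p) (hp : 0 ≤ p) (hγ : γ ≤ 1)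
    {g a b : ℕ} (hg : γ * Fintype.card V ≤ g) (hg0 : 0 < g) (hgn : 4 * g ≤ Fintype.card V)
    (X Y : Finset V) (hX : X.card ≤ a) (hY : Y.card ≤ b) (hga : g ≤ a) (hgb : g ≤ b) :
    edgeCount G X Y ≤ 32 * p * (a * b) := by
  have key : ∀ X Y : Finset V, Disjoint X Y → X.card ≤ a → Y.card ≤ b →
      2 * X.card ≤ Fintype.card V + 1 → 2 * Y.card ≤ Fintype.card V + 1 →
      edgeCount G X Y ≤ 2 * p * (a * b) := by
    intro X Y hXY hX hY hX2 hY2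
    have hs : X.card + Y.card ≤ Fintype.card V := by
      rw [← Finset.card_union_of_disjoint hXY]
      exact Finset.card_le_univ _
    refine (hG.edgeCount_le_of_card_le hXY (a := max X.card g) (b := max Y.card g) hg hg0
      (le_max_left _ _) (le_max_left _ _) (le_max_right _ _) (le_max_right _ _)
      (by omega)).trans ?_
    have h1 : ((max X.card g : ℕ) : ℝ) ≤ a := by exact_mod_cast max_le hX hga
    have h2 : ((max Y.card g : ℕ) : ℝ) ≤ b := by exact_mod_cast max_le hY hgb
    have h3 : 1 + γ ≤ 2 := by linarith
    gcongr
  obtain ⟨X₀, hX₀, Y₀, hY₀, hd, h4⟩ := exists_disjoint_subsets_edgeCount G X Y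
  have hsplit : ∀ Z : Finset V, ∃ Z' ⊆ Z, 2 * Z'.card ≤ Fintype.card V + 1 ∧
      2 * (Z \ Z').card ≤ Fintype.card V + 1 := by
    intro Z
    obtain ⟨Z', hZ', hc⟩ := Finset.exists_subset_card_eq (s := Z) (n := Z.card / 2) (by omega)
    have := Finset.card_le_univ Z
    have h2 := Finset.card_sdiff_of_subset hZ'
    exact ⟨Z', hZ', by omega, by omega⟩
  obtain ⟨X₁, hX₁, hX₁c, hX₂c⟩ := hsplit X₀
  obtain ⟨Y₁, hY₁, hY₁c, hY₂c⟩ := hsplit Y₀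
  rw [edgeCount_sdiff_left G hX₁, edgeCount_sdiff_right G _ hY₁, edgeCount_sdiff_right G X₁ hY₁]
    at h4
  have cX := Finset.card_le_card hX₀
  have cY := Finset.card_le_card hY₀
  have cX₁ := Finset.card_le_card hX₁
  have cY₁ := Finset.card_le_card hY₁
  have cX₂ := Finset.card_le_card (Finset.sdiff_subset (s := X₀) (t := X₁))
  have cY₂ := Finset.card_le_card (Finset.sdiff_subset (s := Y₀) (t := Y₁))
  have e1 := key (X₀ \ X₁) (Y₀ \ Y₁) (hd.mono Finset.sdiff_subset Finset.sdiff_subset)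
    (by omega) (by omega) hX₂c hY₂c
  have e2 := key (X₀ \ X₁) Y₁ (hd.mono Finset.sdiff_subset hY₁)
    (by omega) (by omega) hX₂c hY₁c
  have e3 := key X₁ (Y₀ \ Y₁) (hd.mono hX₁ Finset.sdiff_subset)
    (by omega) (by omega) hX₁c hY₂c
  have e4 := key X₁ Y₁ (hd.mono hX₁ hY₁) (by omega) (by omega) hX₁c hY₁c
  linarith

end Pseudorandom

/-! ### Most vertices have typical degrees -/

section Degrees

open Classical

theorem sum_edgeCount_singleton {V : Type*} (F : SimpleGraph V) (X Y : Finset V) :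
    ∑ v ∈ X, edgeCount F {v} Y = edgeCount F X Y := by
  simp [edgeCount]

variable {V : Type*} [Fintype V] {G : SimpleGraph V} {γ p σ : ℝ}

/-- Supplies a test set of atypical vertices: large enough for pseudorandomness, yet so small that
edges inside it are negligible. -/
theorem exists_subset_card_ceil {S : Finset V} (hσ : 0 < σ) (hσ1 : σ ≤ 1)
    (hn : 200 / σ ≤ Fintype.card V) (hS : σ * Fintype.card V < S.card) :
    ∃ D ⊆ S, 0 < D.card ∧ σ / 200 * Fintype.card V ≤ D.card ∧
      (D.card : ℝ) ≤ σ / 100 * Fintype.card V ∧ 4 * D.card ≤ Fintype.card V := by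
  have hn1 : 1 ≤ σ / 200 * Fintype.card V := by
    rw [div_le_iff₀ hσ] at hn
    linarith
  have hceil : ((⌈σ / 200 * Fintype.card V⌉₊ : ℕ) : ℝ) ≤ σ / 100 * Fintype.card V := by
    have := Nat.ceil_lt_add_one (by linarith : 0 ≤ σ / 200 * (Fintype.card V : ℝ))
    linarith
  have hn0 : (0 : ℝ) < Fintype.card V := by
    by_contra h
    nlinarith
  obtain ⟨D, hD, hc⟩ := Finset.exists_subset_card_eq (s := S)
    (n := ⌈σ / 200 * Fintype.card V⌉₊) (by
      have : ((⌈σ / 200 * Fintype.card V⌉₊ : ℕ) : ℝ) ≤ S.card := by nlinarith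
      exact_mod_cast this)
  refine ⟨D, hD, ?_, ?_, ?_, ?_⟩
  · rw [hc]
    exact Nat.ceil_pos.2 (by linarith)
  · rw [hc]
    exact Nat.le_ceil _
  · rw [hc]
    exact hceil
  · have : 4 * (D.card : ℝ) ≤ Fintype.card V := by
      rw [hc]
      nlinarith
    exact_mod_cast this

theorem IsPseudorandom.card_large_degree_le (hG : IsPseudorandom G γ p) (hp : 0 < p)
    (hσ : 0 < σ) (hσ1 : σ ≤ 1) (hγ0 : 0 ≤ γ) (hγ : γ ≤ σ / 200)
    (hn : 200 / σ ≤ Fintype.card V) (A : Finset V) :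
    ((Finset.univ.filter fun v => p * (A.card + σ * Fintype.card V) < edgeCount G {v} A).card : ℝ)
      ≤ σ * Fintype.card V := by
  by_contra! hcon
  obtain ⟨D, hD, hD0, hDl, hDu, hD4⟩ := exists_subset_card_ceil hσ hσ1 hn hcon
  have hγD : γ * Fintype.card V ≤ D.card := by
    refine le_trans ?_ hDl
    gcongr
  have h1 : (D.card : ℝ) * (p * (A.card + σ * Fintype.card V)) ≤ edgeCount G D A := by
    rw [← sum_edgeCount_singleton]
    simpa using Finset.card_nsmul_le_sum D (fun v => edgeCount G {v} A) _
      (fun v hv => ((Finset.mem_filter.1 (hD hv)).2).le)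
  -- `D` may meet `A`; the edges inside `D` number at most `32 p |D|²`, harmless because `32 |D|` is
  -- below `σ|V|/3`.
  have hsplit : edgeCount G D A ≤ edgeCount G D (A \ D) + edgeCount G D D := by
    rw [edgeCount_sdiff_right G D (Finset.inter_subset_left (s₁ := A) (s₂ := D)),
      Finset.sdiff_inter_self_left]
    gcongr
    exact edgeCount_mono le_rfl subset_rfl Finset.inter_subset_right
  have h2 := hG.edgeCount_le hp.le (by linarith) hγD hD0 hD4 D D le_rfl le_rfl le_rfl le_rfl
  have hADn : (A \ D).card + D.card ≤ Fintype.card V := by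
    rw [← Finset.card_union_of_disjoint Finset.sdiff_disjoint]
    exact Finset.card_le_univ _
  have h3 := hG.edgeCount_le_of_card_le (X := D) (Y := A \ D) Finset.disjoint_sdiff
    (a := D.card) (b := max (A \ D).card D.card) hγD hD0 le_rfl (le_max_left _ _) le_rfl
    (le_max_right _ _) (by omega)
  have hb : ((max (A \ D).card D.card : ℕ) : ℝ) ≤ A.card + D.card := by
    have := Finset.card_le_card (Finset.sdiff_subset (s := A) (t := D))
    have h : max (A \ D).card D.card ≤ A.card + D.card := by omega
    exact_mod_cast h
  have hbn : ((max (A \ D).card D.card : ℕ) : ℝ) ≤ Fintype.card V := by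
    have h : max (A \ D).card D.card ≤ Fintype.card V := by omega
    exact_mod_cast h
  set b : ℝ := ((max (A \ D).card D.card : ℕ) : ℝ)
  have hD0' : (0 : ℝ) < D.card := by exact_mod_cast hD0
  have hn0 : (0 : ℝ) < Fintype.card V := lt_of_lt_of_le (by positivity) hn
  have h4 : (D.card * p) * (A.card + σ * Fintype.card V) ≤
      (D.card * p) * ((1 + γ) * b + 32 * D.card) := by
    nlinarith
  have h5 := le_of_mul_le_mul_left h4 (by positivity)
  have h6 : γ * b ≤ σ / 200 * Fintype.card V := by gcongr
  nlinarith [mul_pos hσ hn0]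

theorem IsPseudorandom.card_small_degree_le (hG : IsPseudorandom G γ p) (hp : 0 < p)
    (hσ : 0 < σ) (hσ1 : σ ≤ 1) (hγ0 : 0 ≤ γ) (hγ : γ ≤ σ / 200)
    (hn : 200 / σ ≤ Fintype.card V) :
    ((Finset.univ.filter fun v =>
        edgeCount G {v} Finset.univ < p * ((1 - σ) * Fintype.card V)).card : ℝ)
      ≤ σ * Fintype.card V := by
  by_contra! hcon
  obtain ⟨D, hD, hD0, hDl, hDu, hD4⟩ := exists_subset_card_ceil hσ hσ1 hn hcon
  have hγD : γ * Fintype.card V ≤ D.card := by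
    refine le_trans ?_ hDl
    gcongr
  have h1 : edgeCount G D Finset.univ ≤ (D.card : ℝ) * (p * ((1 - σ) * Fintype.card V)) := by
    rw [← sum_edgeCount_singleton]
    simpa using Finset.sum_le_card_nsmul D (fun v => edgeCount G {v} Finset.univ) _
      (fun v hv => ((Finset.mem_filter.1 (hD hv)).2).le)
  have hcc : Dᶜ.card = Fintype.card V - D.card := Finset.card_compl D
  have hcR : (Dᶜ.card : ℝ) = Fintype.card V - D.card := by
    rw [hcc, Nat.cast_sub (by omega)]
  have hDc : (D.card : ℝ) ≤ Dᶜ.card := by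
    have : D.card ≤ Dᶜ.card := by omega
    exact_mod_cast this
  have h2 := (abs_le.1 (hG.abs_edgeCount_sub_le (X := D) (Y := Dᶜ) disjoint_compl_right
    (Finset.card_pos.1 hD0) (Finset.card_pos.1 (by omega)) hγD (hγD.trans hDc))).1
  have h3 := edgeCount_mono (le_refl G) (subset_refl D) (Finset.subset_univ Dᶜ)
  have hD0' : (0 : ℝ) < D.card := by exact_mod_cast hD0
  have hn0 : (0 : ℝ) < Fintype.card V := lt_of_lt_of_le (by positivity) hn
  have h4 : (D.card * p) * ((1 - γ) * Dᶜ.card) ≤ (D.card * p) * ((1 - σ) * Fintype.card V) := by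
    nlinarith
  have h5 := le_of_mul_le_mul_left h4 (by positivity)
  have h6 : γ * Dᶜ.card ≤ σ / 200 * Fintype.card V := by
    have : (Dᶜ.card : ℝ) ≤ Fintype.card V := by rw [hcR]; linarith
    gcongr
  nlinarith [mul_pos hσ hn0]

end Degrees

/-! ### Full pairs by density increment -/

section FullPair

open Classical

/-- Any two subsets of `X` and `Y` with at least `t` vertices have an edge of `F` between them. -/
def IsFullPair {V : Type*} (F : SimpleGraph V) (t : ℝ) (X Y : Finset V) : Prop :=
  ∀ X' ⊆ X, ∀ Y' ⊆ Y, t ≤ X'.card → t ≤ Y'.card → ∃ x ∈ X', ∃ y ∈ Y', F.Adj x y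

variable {V : Type*}

/-- Failure of fullness gives an empty `t × t` block with `t ≥ β s`. All edges then lie in the
remaining area `s² - t²`, so one of two rectangles covering it has density at least `(1 + β²) D`;
averaging makes it square. -/
theorem exists_denser_pair {F : SimpleGraph V} {X Y : Finset V} {s : ℕ} {β D : ℝ} (hβ0 : 0 < β)
    (hβ : β ≤ 1 / 4) (hD : 0 < D) (hX : X.card = s) (hY : Y.card = s) (hs : 4 ≤ s)
    (he : D * s ^ 2 ≤ edgeCount F X Y) (hfull : ¬ IsFullPair F (β * s) X Y) :
    ∃ X' ⊆ X, ∃ Y' ⊆ Y, ∃ s' : ℕ, X'.card = s' ∧ Y'.card = s' ∧ β * s ≤ s' ∧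
      (1 + β ^ 2) * D * s' ^ 2 ≤ edgeCount F X' Y' := by
  simp only [IsFullPair, not_forall, not_exists, not_and] at hfull
  obtain ⟨X', hX', Y', hY', hXc, hYc, hno⟩ := hfull
  obtain ⟨t, ht⟩ : ∃ t, t = ⌈β * s⌉₊ := ⟨_, rfl⟩
  have hs4 : (4 : ℝ) ≤ s := by exact_mod_cast hs
  have htl : β * s ≤ t := ht ▸ Nat.le_ceil _
  have htu : (t : ℝ) ≤ s / 2 := by
    have := Nat.ceil_lt_add_one (by positivity : 0 ≤ β * (s : ℝ))
    rw [← ht] at this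
    nlinarith
  have hts : 2 * t ≤ s := by
    have : (2 : ℝ) * t ≤ s := by linarith
    exact_mod_cast this
  have ht0 : (0 : ℝ) < t := lt_of_lt_of_le (by positivity) htl
  obtain ⟨A, hA, hAc⟩ := Finset.exists_subset_card_eq (s := X') (n := t)
    (ht ▸ Nat.ceil_le.2 hXc)
  obtain ⟨B, hB, hBc⟩ := Finset.exists_subset_card_eq (s := Y') (n := t)
    (ht ▸ Nat.ceil_le.2 hYc)
  have hAB : edgeCount F A B = 0 :=
    edgeCount_eq_zero fun x hx y hy => hno x (hA hx) y (hB hy)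
  rw [edgeCount_sdiff_left F (hA.trans hX'), edgeCount_sdiff_right F A (hB.trans hY'), hAB,
    add_zero] at he
  have hXA : (X \ A).card = s - t := by
    rw [Finset.card_sdiff_of_subset (hA.trans hX'), hX, hAc]
  have hYB : (Y \ B).card = s - t := by
    rw [Finset.card_sdiff_of_subset (hB.trans hY'), hY, hBc]
  have hst : ((s - t : ℕ) : ℝ) = s - t := Nat.cast_sub (by omega)
  have hst0 : (0 : ℝ) < s - t := by linarith
  have hs0 : (0 : ℝ) < s := by linarith
  have hor : (1 + β ^ 2) * D * ((s - t) * s) ≤ edgeCount F (X \ A) Y ∨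
      (1 + β ^ 2) * D * (t * (s - t)) ≤ edgeCount F A (Y \ B) := by
    by_contra! hcon
    have h1 : D * (s : ℝ) ^ 2 < D * ((1 + β ^ 2) * (s ^ 2 - t ^ 2)) := by nlinarith
    have h2 := lt_of_mul_lt_mul_left h1 hD.le
    have h3 : (β * s) ^ 2 ≤ (t : ℝ) ^ 2 := by gcongr
    have h4 : 0 < (β * s) ^ 2 := by positivity
    have h5 : (1 + β ^ 2) * ((s : ℝ) ^ 2 - t ^ 2) ≤ (1 + β ^ 2) * (s ^ 2 - (β * s) ^ 2) := by
      gcongr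
    nlinarith [mul_pos h4 (by positivity : 0 < β ^ 2)]
  rcases hor with h | h
  · obtain ⟨Y₁, hY₁, hY₁c, hle⟩ := exists_subset_right_edgeCount F (X \ A) Y (k := s - t)
      (by omega)
    refine ⟨X \ A, Finset.sdiff_subset, Y₁, hY₁, s - t, hXA, hY₁c, ?_, ?_⟩
    · rw [hst]
      linarith
    · rw [hst, hY] at *
      refine le_of_mul_le_mul_left ?_ hs0
      calc _ = ((s : ℝ) - t) * ((1 + β ^ 2) * D * ((s - t) * s)) := by ring
        _ ≤ ((s : ℝ) - t) * edgeCount F (X \ A) Y := by gcongr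
        _ ≤ _ := hle
  · obtain ⟨Y₁, hY₁, hY₁c, hle⟩ := exists_subset_right_edgeCount F A (Y \ B) (k := t)
      (by omega)
    refine ⟨A, hA.trans hX', Y₁, hY₁.trans Finset.sdiff_subset, t, hAc, hY₁c, htl, ?_⟩
    rw [hYB, hst] at hle
    refine le_of_mul_le_mul_left ?_ hst0
    calc _ = (t : ℝ) * ((1 + β ^ 2) * D * (t * (s - t))) := by ring
      _ ≤ (t : ℝ) * edgeCount F A (Y \ B) := by gcongr
      _ ≤ _ := hle

theorem exists_equal_card_pair {F : SimpleGraph V} {X Y : Finset V} {D : ℝ} (hD : 0 ≤ D)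
    (he : D * (X.card * Y.card) ≤ edgeCount F X Y) :
    ∃ X' ⊆ X, ∃ Y' ⊆ Y, X'.card = min X.card Y.card ∧ Y'.card = min X.card Y.card ∧
      D * (min X.card Y.card : ℕ) ^ 2 ≤ edgeCount F X' Y' := by
  have key : ∀ X Y : Finset V, D * (X.card * Y.card) ≤ edgeCount F X Y → X.card ≤ Y.card →
      ∃ Y' ⊆ Y, Y'.card = X.card ∧ D * (X.card : ℝ) ^ 2 ≤ edgeCount F X Y' := by
    intro X Y he hle
    obtain ⟨Y', hY', hc, h⟩ := exists_subset_right_edgeCount F X Y hle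
    refine ⟨Y', hY', hc, ?_⟩
    rcases Nat.eq_zero_or_pos Y.card with h0 | h0
    · have : X.card = 0 := by omega
      simp [this, edgeCount_nonneg]
    · have h0' : (0 : ℝ) < Y.card := by exact_mod_cast h0
      refine le_of_mul_le_mul_left ?_ h0'
      calc _ = (X.card : ℝ) * (D * (X.card * Y.card)) := by ring
        _ ≤ X.card * edgeCount F X Y := by gcongr
        _ ≤ _ := h
  rcases le_total X.card Y.card with h | h
  · obtain ⟨Y', h1, h2, h3⟩ := key X Y he h
    rw [min_eq_left h]
    exact ⟨X, subset_rfl, Y', h1, rfl, h2, h3⟩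
  · obtain ⟨X', h1, h2, h3⟩ := key Y X (by rw [edgeCount_comm, mul_comm (Y.card : ℝ)]; exact he) h
    rw [min_eq_right h]
    exact ⟨X', h1, Y, subset_rfl, h2, rfl, by rw [edgeCount_comm]; exact h3⟩

/-- A density increment argument: dense bipartite graphs whose density is bounded on all large
pairs contain large full pairs. -/
theorem exists_isFullPair {β η : ℝ} (hβ0 : 0 < β) (hβ : β ≤ 1 / 4) (hη : 0 < η) :
    ∃ τ : ℝ, 0 < τ ∧ τ ≤ 1 ∧ ∀ (V : Type*) [Fintype V] (F : SimpleGraph V) (p : ℝ), 0 < p →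
      4 / τ ≤ Fintype.card V →
      (∀ (X Y : Finset V) (a b : ℕ), X.card ≤ a → Y.card ≤ b → τ * Fintype.card V ≤ a →
        τ * Fintype.card V ≤ b → edgeCount F X Y ≤ 32 * p * (a * b)) →
      ∀ X₀ Y₀ : Finset V, η * p * (Fintype.card V : ℝ) ^ 2 ≤ edgeCount F X₀ Y₀ →
      ∃ X ⊆ X₀, ∃ Y ⊆ Y₀, Disjoint X Y ∧ X.card = Y.card ∧ τ * Fintype.card V ≤ X.card ∧
        IsFullPair F (β * X.card) X Y := by
  -- From initial density `η p / 4`, `K` increments would exceed the cap `32 p`.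
  obtain ⟨K, hK⟩ := pow_unbounded_of_one_lt (128 / η)
    (by nlinarith [sq_nonneg β, pow_pos hβ0 2] : (1 : ℝ) < 1 + β ^ 2)
  have hKpow : ∀ k, β ^ k ≤ 1 := fun k => pow_le_one₀ hβ0.le (by linarith)
  set c : ℝ := min (η / 256) 1 with hc
  have hc0 : 0 < c := lt_min (by positivity) one_pos
  refine ⟨β ^ (K + 1) * c, by positivity, ?_, ?_⟩
  · exact mul_le_one₀ (hKpow _) hc0.le (min_le_right _ _)
  intro V _ F p hp hn hU X₀ Y₀ he
  set τ : ℝ := β ^ (K + 1) * c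
  have hτ : 0 < τ := by positivity
  have hτc : τ ≤ c / 4 := by
    have : β ^ (K + 1) ≤ 1 / 4 := by
      rw [pow_succ]
      nlinarith [hKpow K, pow_pos hβ0 K]
    nlinarith
  set n : ℝ := (Fintype.card V : ℝ) with hndef
  have hτn : 4 ≤ τ * n := by
    rw [div_le_iff₀ hτ] at hn
    linarith
  have hn0 : 0 < n := lt_of_lt_of_le (by positivity) hn
  obtain ⟨X₁, hX₁, Y₁, hY₁, hd, h4⟩ := exists_disjoint_subsets_edgeCount F X₀ Y₀
  -- A side below `c n` would carry at most `40 c p n²` edges, too few since `c ≤ η / 256`.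
  have hlarge : ∀ X Y : Finset V, η * p * n ^ 2 ≤ 4 * edgeCount F X Y → c * n ≤ X.card := by
    intro X Y h
    by_contra! hcon
    have hcn : c * n + 1 ≤ 2 * (c * n) := by nlinarith
    have h1 := hU X Y ⌈c * n⌉₊ (Fintype.card V)
      (by
        have := Nat.le_ceil (c * n)
        have : (X.card : ℝ) ≤ (⌈c * n⌉₊ : ℕ) := by linarith
        exact_mod_cast this)
      (Finset.card_le_univ _)
      (by
        have := Nat.le_ceil (c * n)
        nlinarith)
      (by nlinarith [min_le_right (η / 256) 1])
    have h2 : ((⌈c * n⌉₊ : ℕ) : ℝ) < 5 / 4 * (c * n) := by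
      have := Nat.ceil_lt_add_one (by positivity : 0 ≤ c * n)
      nlinarith
    have h3 : 32 * p * ((⌈c * n⌉₊ : ℕ) * n) < 32 * p * (5 / 4 * (c * n) * n) := by gcongr
    have h4 : c ≤ η / 256 := min_le_left _ _
    have h5 : 32 * p * (5 / 4 * (c * n) * n) ≤ 32 * p * (5 / 4 * (η / 256 * n) * n) := by gcongr
    have h6 : 0 < η * p * n ^ 2 := by positivity
    rw [← hndef] at h1
    nlinarith
  have hlX := hlarge X₁ Y₁ (by linarith)
  have hlY := hlarge Y₁ X₁ (by rw [edgeCount_comm]; linarith)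
  by_contra! hno
  have hind : ∀ k ≤ K, ∃ X ⊆ X₁, ∃ Y ⊆ Y₁, ∃ s : ℕ, X.card = s ∧ Y.card = s ∧
      β ^ k * (c * n) ≤ s ∧ (1 + β ^ 2) ^ k * (η / 4 * p) * s ^ 2 ≤ edgeCount F X Y := by
    intro k
    induction k with
    | zero =>
      intro _
      have hXn : (X₁.card : ℝ) ≤ n := Nat.cast_le.2 (Finset.card_le_univ X₁)
      have hYn : (Y₁.card : ℝ) ≤ n := Nat.cast_le.2 (Finset.card_le_univ Y₁)
      have h5 : (X₁.card : ℝ) * Y₁.card ≤ n * n := by gcongr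
      have h6 : η / 4 * p * (X₁.card * Y₁.card) ≤ η / 4 * p * (n * n) := by gcongr
      obtain ⟨X, hX, Y, hY, hXc, hYc, h⟩ := exists_equal_card_pair (F := F) (X := X₁) (Y := Y₁)
        (D := η / 4 * p) (by positivity) (by nlinarith)
      refine ⟨X, hX, Y, hY, _, hXc, hYc, ?_, by simpa using h⟩
      rw [Nat.cast_min, pow_zero, one_mul]
      exact le_min hlX hlY
    | succ k ih =>
      intro hk
      obtain ⟨X, hX, Y, hY, s, hXc, hYc, hs, hXY⟩ := ih (by omega)
      have hsτ : τ * n ≤ s := by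
        refine le_trans ?_ hs
        have : β ^ (K + 1) ≤ β ^ k := pow_le_pow_of_le_one hβ0.le (by linarith) (by omega)
        calc τ * n = β ^ (K + 1) * (c * n) := by ring
          _ ≤ _ := by gcongr
      have hfull := hno X (hX.trans hX₁) Y (hY.trans hY₁) (hd.mono hX hY) (hXc.trans hYc.symm)
        (by rw [hXc]; exact hsτ)
      rw [hXc] at hfull
      obtain ⟨X', hX', Y', hY', s', h1, h2, h3, h4⟩ := exists_denser_pair hβ0 hβ
        (by positivity) hXc hYc (by exact_mod_cast hτn.trans hsτ) hXY hfull
      refine ⟨X', hX'.trans hX, Y', hY'.trans hY, s', h1, h2, ?_, ?_⟩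
      · calc β ^ (k + 1) * (c * n) = β * (β ^ k * (c * n)) := by ring
          _ ≤ β * s := by gcongr
          _ ≤ _ := h3
      · calc _ = (1 + β ^ 2) * ((1 + β ^ 2) ^ k * (η / 4 * p)) * (s' : ℝ) ^ 2 := by ring
          _ ≤ _ := h4
  obtain ⟨X, hX, Y, hY, s, hXc, hYc, hs, hXY⟩ := hind K le_rfl
  have hsτ : τ * n ≤ s := by
    refine le_trans ?_ hs
    have : β ^ (K + 1) ≤ β ^ K := pow_le_pow_of_le_one hβ0.le (by linarith) (by omega)
    calc τ * n = β ^ (K + 1) * (c * n) := by ring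
      _ ≤ _ := by gcongr
  have h1 := hU X Y s s hXc.le hYc.le hsτ hsτ
  have hs0 : (0 : ℝ) < s := by linarith
  have h2 : (p * (s : ℝ) ^ 2) * ((1 + β ^ 2) ^ K * (η / 4)) ≤ (p * (s : ℝ) ^ 2) * 32 := by
    nlinarith
  have h3 := le_of_mul_le_mul_left h2 (by positivity)
  rw [div_lt_iff₀ hη] at hK
  linarith

end FullPair

/-! ### Long paths by depth first search -/

section DepthFirstSearch

open Classical

variable {V : Type*}

/-- The second conjunct strengthens the induction: a head outside `P` saves the extra 1. -/
theorem List.two_mul_countP_le (P : V → Prop) [DecidablePred P] (l : List V)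
    (h : l.IsChain fun u v => ¬ (P u ∧ P v)) :
    2 * l.countP (fun v => decide (P v)) ≤ l.length + 1 ∧
      (∀ a ∈ l.head?, ¬ P a → 2 * l.countP (fun v => decide (P v)) ≤ l.length) := by
  induction l with
  | nil => simp
  | cons a l ih =>
    obtain ⟨ih1, ih2⟩ := ih h.tail
    by_cases ha : P a
    · refine ⟨?_, fun b hb hnb => absurd ha (by simp at hb; rwa [hb])⟩
      rw [List.countP_cons_of_pos (by simpa using ha)]
      cases l with
      | nil => simp
      | cons b l =>
        have hb : ¬ P b := fun hb => (List.isChain_cons_cons.1 h).1 ⟨ha, hb⟩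
        have := ih2 b (by simp) hb
        simp only [List.length_cons] at *
        omega
    · rw [List.countP_cons_of_neg (by simpa using ha)]
      simp only [List.length_cons]
      exact ⟨by omega, fun _ _ _ => by omega⟩

theorem List.card_toFinset_filter_eq_countP (P : V → Prop) [DecidablePred P] (l : List V) (h : l.Nodup) :
    (l.toFinset.filter P).card = l.countP (fun v => decide (P v)) := by
  have : l.toFinset.filter P = (l.filter fun v => decide (P v)).toFinset := by
    ext v
    simp
  rw [this, List.toFinset_card_of_nodup (h.filter _), List.countP_eq_length_filter]

/-- If there is an edge between any two `t`-subsets of the two sides of a balanced bipartite graph,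
then depth first search finds a path missing few vertices. -/
theorem exists_path_of_card_eq {F : SimpleGraph V} {X Y : Finset V} {t N : ℕ}
    (hXY : Disjoint X Y) (hX : X.card = N) (hY : Y.card = N)
    (hfull : ∀ X' ⊆ X, ∀ Y' ⊆ Y, t ≤ X'.card → t ≤ Y'.card → ∃ x ∈ X', ∃ y ∈ Y', F.Adj x y) :
    ∃ l : List V, l.Nodup ∧ l.IsChain F.Adj ∧ (∀ v ∈ l, v ∈ X ∪ Y) ∧
      2 * N ≤ l.length + 4 * t + 1 := by
  rcases lt_or_ge N t with hNt | hNt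
  · exact ⟨[], by simp, by simp, by simp, by simp; omega⟩
  have ht0 : 0 < t := by
    rcases Nat.eq_zero_or_pos t with rfl | h
    · obtain ⟨x, hx, -⟩ := hfull ∅ (by simp) ∅ (by simp) (by simp) (by simp)
      simp at hx
    · exact h
  let R : V → V → Prop := fun u v => F.Adj u v ∧ (u ∈ X ∧ v ∈ Y ∨ u ∈ Y ∧ v ∈ X)
  have hRs : ∀ u v, R u v → R v u := fun u v h => ⟨h.1.symm, by have := h.2; tauto⟩
  have hdis : ∀ v, v ∈ X → v ∉ Y := fun v h1 h2 => Finset.disjoint_left.1 hXY h1 h2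
  by_contra! hno
  have hshort : ∀ l : List V, l.Nodup → l.IsChain R → (∀ v ∈ l, v ∈ X ∪ Y) →
      l.length + 4 * t + 1 < 2 * N :=
    fun l h1 h2 h3 => hno l h1 (h2.imp fun _ _ h => h.1) h3
  -- One side cannot have at most `t` dead and at most `t` untouched vertices: the alternating path
  -- would contain the rest of it and so be too long.
  have hcount : ∀ Z : Finset V, (Z = X ∨ Z = Y) → ∀ (l : List V) (D : Finset V), l.Nodup →
      l.IsChain R → (∀ v ∈ l, v ∈ X ∪ Y) → (D ∩ Z).card ≤ t →
      (Z \ (D ∪ l.toFinset)).card ≤ t → False := by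
    intro Z hZ l D h1 h2 h3 h4 h5
    have h6 := hshort l h1 h2 h3
    have hZc : Z.card = N := by rcases hZ with rfl | rfl <;> assumption
    have h7 := (List.two_mul_countP_le (fun v => v ∈ Z) l (h2.imp fun u v h => by
      have := hdis u
      have := hdis v
      rcases hZ with rfl | rfl <;> (have := h.2; tauto))).1
    have h11 : (l.toFinset.filter fun v => v ∈ Z).card = l.countP fun v => decide (v ∈ Z) :=
      List.card_toFinset_filter_eq_countP _ _ h1
    rw [← h11] at h7
    have h8 : Z.card ≤ ((D ∩ Z) ∪ (Z \ (D ∪ l.toFinset)) ∪ l.toFinset.filter (· ∈ Z)).card := by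
      refine Finset.card_le_card fun v hv => ?_
      simp only [Finset.mem_union, Finset.mem_inter, Finset.mem_sdiff, Finset.mem_filter,
        List.mem_toFinset]
      tauto
    have h9 := Finset.card_union_le ((D ∩ Z) ∪ (Z \ (D ∪ l.toFinset)))
      (l.toFinset.filter (· ∈ Z))
    have h10 := Finset.card_union_le (D ∩ Z) (Z \ (D ∪ l.toFinset))
    omega
  -- Search state after `k` moves: `l` is the current path, `D` the dead vertices, with no edge from
  -- `D` to untouched vertices. A vertex counts once when pushed and once more when it dies. If the
  -- dead part of one side reached `t`, fullness would leave fewer than `t` untouched vertices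
  -- opposite, contradicting `hcount`; so the search never stops.
  have hstate : ∀ k : ℕ, ∃ (l : List V) (D : Finset V), l.Nodup ∧ l.IsChain R ∧
      (∀ v ∈ l, v ∈ X ∪ Y) ∧ D ⊆ X ∪ Y ∧ (∀ v ∈ l, v ∉ D) ∧
      (∀ u ∈ D, ∀ v, v ∉ D → v ∉ l → ¬ R u v) ∧ (D ∩ X).card < t ∧ (D ∩ Y).card < t ∧
      2 * D.card + l.length = k := by
    intro k
    induction k with
    | zero => exact ⟨[], ∅, by simp [ht0]⟩
    | succ k ih =>
      obtain ⟨l, D, h1, h2, h3, h4, h5, h6, h7, h8, h9⟩ := ih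
      rcases l with _ | ⟨a, l⟩
      · have hne : ¬ X ⊆ D := fun h => by
          rw [Finset.inter_eq_right.2 h] at h7
          omega
        obtain ⟨s, hsX, hsD⟩ := Finset.not_subset.1 hne
        refine ⟨[s], D, by simp, by simp, by simp [hsX], h4, by simpa using hsD, ?_, h7, h8, ?_⟩
        · exact fun u hu v hv _ => h6 u hu v hv (by simp)
        · simp at h9 ⊢
          omega
      · by_cases hs : ∃ s, s ∉ D ∧ s ∉ a :: l ∧ R s a
        · obtain ⟨s, hsD, hsl, hR⟩ := hs
          refine ⟨s :: a :: l, D, List.nodup_cons.2 ⟨hsl, h1⟩, List.isChain_cons_cons.2 ⟨hR, h2⟩,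
            ?_, h4, ?_, ?_, h7, h8, ?_⟩
          · intro v hv
            rcases List.mem_cons.1 hv with rfl | hv
            · have := hR.2
              rw [Finset.mem_union]
              tauto
            · exact h3 v hv
          · intro v hv
            rcases List.mem_cons.1 hv with rfl | hv
            · exact hsD
            · exact h5 v hv
          · exact fun u hu v hv hvl => h6 u hu v hv fun h => hvl (List.mem_cons_of_mem _ h)
          · simp at h9 ⊢
            omega
        · push Not at hs
          have haD : a ∉ D := h5 a (by simp)
          have hal : a ∉ l := (List.nodup_cons.1 h1).1
          have hnl := (List.nodup_cons.1 h1).2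
          have h6' : ∀ u ∈ insert a D, ∀ v, v ∉ insert a D → v ∉ l → ¬ R u v := by
            intro u hu v hv hvl hR
            simp only [Finset.mem_insert, not_or] at hu hv
            rcases hu with rfl | hu
            · exact hs v hv.2 (by simp [hv.1, hvl]) (hRs _ _ hR)
            · exact h6 u hu v hv.2 (by simp [hv.1, hvl]) hR
          have h3' : ∀ v ∈ l, v ∈ X ∪ Y := fun v hv => h3 v (List.mem_cons_of_mem _ hv)
          have hins : ∀ Z : Finset V, (insert a D ∩ Z).card ≤ (D ∩ Z).card + 1 := by
            intro Z
            refine (Finset.card_le_card ?_).trans (Finset.card_insert_le a (D ∩ Z))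
            intro v
            simp only [Finset.mem_inter, Finset.mem_insert]
            tauto
          have hbX : (insert a D ∩ X).card < t := by
            by_contra! hge
            refine hcount Y (Or.inr rfl) l (insert a D) hnl h2.tail h3' (by have := hins Y; omega)
              (le_of_not_ge fun hge' => ?_)
            obtain ⟨x, hx, y, hy, hxy⟩ := hfull _ Finset.inter_subset_right _ Finset.sdiff_subset
              hge hge'
            simp only [Finset.mem_sdiff, Finset.mem_union, List.mem_toFinset, not_or] at hy
            rw [Finset.mem_inter] at hx
            exact h6' x hx.1 y hy.2.1 hy.2.2 ⟨hxy, Or.inl ⟨hx.2, hy.1⟩⟩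
          have hbY : (insert a D ∩ Y).card < t := by
            by_contra! hge
            refine hcount X (Or.inl rfl) l (insert a D) hnl h2.tail h3' (by have := hins X; omega)
              (le_of_not_ge fun hge' => ?_)
            obtain ⟨x, hx, y, hy, hxy⟩ := hfull _ Finset.sdiff_subset _ Finset.inter_subset_right
              hge' hge
            simp only [Finset.mem_sdiff, Finset.mem_union, List.mem_toFinset, not_or] at hx
            rw [Finset.mem_inter] at hy
            exact h6' y hy.1 x hx.2.1 hx.2.2 ⟨hxy.symm, Or.inr ⟨hy.2, hx.1⟩⟩
          refine ⟨l, insert a D, hnl, h2.tail, h3', ?_, ?_, h6', hbX, hbY, ?_⟩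
          · exact Finset.insert_subset (h3 a (by simp)) h4
          · intro v hv
            rw [Finset.mem_insert, not_or]
            exact ⟨fun h => hal (h ▸ hv), h5 v (List.mem_cons_of_mem _ hv)⟩
          · rw [Finset.card_insert_of_notMem haD]
            simp at h9 ⊢
            omega
  obtain ⟨l, D, h1, h2, h3, h4, h5, h6, h7, h8, h9⟩ := hstate (4 * (X ∪ Y).card + 1)
  have c1 := Finset.card_le_card h4
  have c2 : l.toFinset.card ≤ (X ∪ Y).card :=
    Finset.card_le_card fun v hv => h3 v (List.mem_toFinset.1 hv)
  rw [List.toFinset_card_of_nodup h1] at c2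
  omega

theorem IsFullPair.exists_path {F : SimpleGraph V} {X Y X₀ Y₀ : Finset V} {t : ℝ}
    (hfull : IsFullPair F t X₀ Y₀) (hX : X ⊆ X₀) (hY : Y ⊆ Y₀) (hXY : Disjoint X Y) :
    ∃ l : List V, l.Nodup ∧ l.IsChain F.Adj ∧ (∀ v ∈ l, v ∈ X ∪ Y) ∧
      2 * min X.card Y.card ≤ l.length + 4 * ⌈t⌉₊ + 1 := by
  obtain ⟨X', hX', hXc⟩ := Finset.exists_subset_card_eq (min_le_left X.card Y.card)
  obtain ⟨Y', hY', hYc⟩ := Finset.exists_subset_card_eq (min_le_right X.card Y.card)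
  obtain ⟨l, h1, h2, h3, h4⟩ := exists_path_of_card_eq (F := F) (t := ⌈t⌉₊)
    (hXY.mono hX' hY') hXc hYc fun A hA B hB hAc hBc =>
      hfull A (hA.trans (hX'.trans hX)) B (hB.trans (hY'.trans hY)) (Nat.ceil_le.1 hAc)
        (Nat.ceil_le.1 hBc)
  exact ⟨l, h1, h2, fun v hv => Finset.union_subset_union hX' hY' (h3 v hv), h4⟩

end DepthFirstSearch

/-! ### Rounding weights to half-integral covers -/

section Rounding

open Classical

theorem sum_union_le_of_add_le {V : Type*} {X Y : Finset V} (hXY : Disjoint X Y) (hc : X.card = Y.card)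
    (hX : 0 < X.card) {w : V → ℝ} {b : ℝ} (h : ∀ x ∈ X, ∀ y ∈ Y, w x + w y ≤ b) :
    ∑ v ∈ X ∪ Y, w v ≤ X.card * b := by
  rw [Finset.sum_union hXY]
  have hX' : (0 : ℝ) < X.card := by exact_mod_cast hX
  refine le_of_mul_le_mul_left ?_ hX'
  have h1 : ∑ x ∈ X, ∑ y ∈ Y, (w x + w y) ≤ ∑ x ∈ X, ∑ y ∈ Y, b :=
    Finset.sum_le_sum fun x hx => Finset.sum_le_sum fun y hy => h x hx y hy
  simp only [Finset.sum_add_distrib, Finset.sum_const, nsmul_eq_mul, ← hc,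
    ← Finset.mul_sum] at h1
  linarith

variable {V : Type*} [Fintype V]

/-- Twice the rounded value at threshold `t` is `[t ≤ a] + [2N - t < a]`. As `t` runs over `1, …, N`
these count disjoint ranges of integers up to `a`. -/
theorem sum_Icc_halfIntegral_le (N a : ℕ) :
    ∑ t ∈ Finset.Icc 1 N, (2 * (if 2 * N < a + t then 1 else 0) +
      (if t ≤ a ∧ a + t ≤ 2 * N then 1 else 0)) ≤ a := by
  have h : ∀ t ∈ Finset.Icc 1 N, (2 * (if 2 * N < a + t then 1 else 0) +
      (if t ≤ a ∧ a + t ≤ 2 * N then 1 else 0)) =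
      (if t ≤ a then 1 else 0) + (if 2 * N < a + t then 1 else 0) := by
    intro t ht
    rw [Finset.mem_Icc] at ht
    split_ifs <;> omega
  rw [Finset.sum_congr rfl h, Finset.sum_add_distrib, ← Finset.card_filter, ← Finset.card_filter]
  have h1 : (Finset.Icc 1 N).filter (· ≤ a) ⊆ Finset.Icc 1 (min a N) := by
    intro t
    simp only [Finset.mem_filter, Finset.mem_Icc, le_min_iff]
    omega
  have h2 : (Finset.Icc 1 N).filter (fun t => 2 * N < a + t) ⊆ Finset.Ioc (2 * N - a) N := by
    intro t
    simp only [Finset.mem_filter, Finset.mem_Icc, Finset.mem_Ioc]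
    omega
  have h3 := Finset.card_le_card h1
  have h4 := Finset.card_le_card h2
  rw [Nat.card_Icc] at h3
  rw [Nat.card_Ioc] at h4
  omega

theorem exists_threshold (w : V → ℕ) {N : ℕ} (hN : 0 < N) :
    ∃ t, 1 ≤ t ∧ t ≤ N ∧
      N * (2 * (Finset.univ.filter fun v => 2 * N < w v + t).card +
        (Finset.univ.filter fun v => t ≤ w v ∧ w v + t ≤ 2 * N).card) ≤ ∑ v, w v := by
  obtain ⟨t, ht, h⟩ := Finset.exists_le_of_sum_le (s := Finset.Icc 1 N)
    (f := fun t => N * (2 * (Finset.univ.filter fun v => 2 * N < w v + t).card +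
        (Finset.univ.filter fun v => t ≤ w v ∧ w v + t ≤ 2 * N).card))
    (g := fun _ => ∑ v, w v) (Finset.nonempty_Icc.2 hN) (by
      rw [← Finset.mul_sum, Finset.sum_const, Nat.card_Icc, smul_eq_mul, Nat.add_sub_cancel]
      refine Nat.mul_le_mul_left _ ?_
      simp only [Finset.card_filter]
      simp_rw [Finset.mul_sum, ← Finset.sum_add_distrib]
      rw [Finset.sum_comm]
      exact Finset.sum_le_sum fun v _ => sum_Icc_halfIntegral_le N (w v))
  rw [Finset.mem_Icc] at ht
  exact ⟨t, ht.1, ht.2, h⟩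

/-- The edges of `F` not covered by the half-integral vertex cover with value `1` on `A` and
value `1 / 2` on `B`. -/
def SimpleGraph.uncovered {V : Type*} (F : SimpleGraph V) (A B : Finset V) : SimpleGraph V where
  Adj u v := F.Adj u v ∧ u ∉ A ∧ v ∉ A ∧ ¬ (u ∈ B ∧ v ∈ B)
  symm := ⟨fun _ _ h => ⟨h.1.symm, h.2.2.1, h.2.1, fun h' => h.2.2.2 h'.symm⟩⟩
  loopless := ⟨fun _ h => F.loopless.irrefl _ h.1⟩

/-- An edge missed by the rounded cover has one end of value below `t` and the other at most `2N -
t`, so its scaled weights sum to less than `2N`. The term `1 / N` absorbs the floors. -/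
theorem exists_light_dense_pair [Nonempty V] {F : SimpleGraph V} {M c : ℝ} (hM : 0 < M) {N : ℕ}
    (hN : 0 < N)
    (hunc : ∀ A B : Finset V, Disjoint A B → 2 * (A.card : ℝ) + B.card ≤ M →
      c < edgeCount (F.uncovered A B) Finset.univ Finset.univ)
    (w : V → ℝ) (hw : ∀ v, 0 < w v) :
    ∃ X Y : Finset V, c / 2 ≤ edgeCount F X Y ∧
      ∀ x ∈ X, ∀ y ∈ Y, M * (w x + w y) ≤ (2 + 1 / N) * ∑ v, w v := by
  set W := ∑ v, w v with hWdef
  have hW : 0 < W := Finset.sum_pos (fun v _ => hw v) Finset.univ_nonempty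
  have hN' : (0 : ℝ) < N := by exact_mod_cast hN
  let a : V → ℕ := fun v => ⌊N * M * w v / W⌋₊
  obtain ⟨t, ht1, htN, ht⟩ := exists_threshold a hN
  set A := Finset.univ.filter fun v => 2 * N < a v + t
  set B := Finset.univ.filter fun v => t ≤ a v ∧ a v + t ≤ 2 * N
  have hsum : ((∑ v, a v : ℕ) : ℝ) ≤ N * M := by
    push_cast
    calc ∑ v, (a v : ℝ) ≤ ∑ v, N * M * w v / W :=
          Finset.sum_le_sum fun v _ => Nat.floor_le (by have := hw v; positivity)
      _ = N * M := by
          rw [← Finset.sum_div, ← Finset.mul_sum, ← hWdef]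
          field_simp
  have hcard : 2 * (A.card : ℝ) + B.card ≤ M := by
    refine le_of_mul_le_mul_left (le_trans ?_ hsum) hN'
    exact_mod_cast ht
  have hAB : Disjoint A B := by
    rw [Finset.disjoint_left]
    intro v
    simp only [A, B, Finset.mem_filter, Finset.mem_univ, true_and]
    omega
  set X := Finset.univ.filter fun v => a v < t
  set Y := Finset.univ.filter fun v => a v + t ≤ 2 * N
  refine ⟨X, Y, ?_, ?_⟩
  · have h1 := hunc A B hAB hcard
    have h2 : edgeCount (F.uncovered A B) Finset.univ Finset.univ ≤
        edgeCount F X Y + edgeCount F Y X := by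
      have hr : ∀ P Q : Finset V, edgeCount F P Q = ∑ x, ∑ y,
          if x ∈ P ∧ y ∈ Q ∧ F.Adj x y then (1 : ℝ) else 0 := by
        intro P Q
        unfold edgeCount
        rw [← Finset.sum_ite_mem_eq P]
        refine Finset.sum_congr rfl fun x _ => ?_
        by_cases hx : x ∈ P
        · simp only [hx, if_true, true_and]
          rw [← Finset.sum_ite_mem_eq Q]
          exact Finset.sum_congr rfl fun y _ => by rw [ite_and]
        · simp [hx]
      rw [hr X Y, hr Y X, ← Finset.sum_add_distrib]
      refine Finset.sum_le_sum fun x _ => ?_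
      rw [← Finset.sum_add_distrib]
      refine Finset.sum_le_sum fun y _ => ?_
      by_cases h : (F.uncovered A B).Adj x y
      · rw [if_pos h]
        obtain ⟨hF, hxA, hyA, hB⟩ := h
        simp only [A, B, X, Y, Finset.mem_filter, Finset.mem_univ, true_and] at hxA hyA hB ⊢
        have hor : a x < t ∨ a y < t := by omega
        rcases hor with h | h
        · rw [if_pos ⟨h, by omega, hF⟩]
          split_ifs <;> norm_num
        · rw [if_pos (c := a x + t ≤ 2 * N ∧ a y < t ∧ F.Adj x y) ⟨by omega, h, hF⟩]
          split_ifs <;> norm_num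
      · rw [if_neg h]
        split_ifs <;> norm_num
    rw [edgeCount_comm F Y X] at h2
    linarith
  · intro x hx y hy
    simp only [X, Y, Finset.mem_filter, Finset.mem_univ, true_and] at hx hy
    have h1 := Nat.lt_floor_add_one (N * M * w x / W)
    have h2 := Nat.lt_floor_add_one (N * M * w y / W)
    have h3 : a x + a y + 1 ≤ 2 * N := by omega
    have h4 : (a x : ℝ) + a y + 1 ≤ 2 * N := by exact_mod_cast h3
    have h5 : N * M * w x / W + N * M * w y / W ≤ 2 * N + 1 := by
      change _ < (a x : ℝ) + 1 at h1
      change _ < (a y : ℝ) + 1 at h2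
      linarith
    rw [← add_div, div_le_iff₀ hW] at h5
    refine le_of_mul_le_mul_left ?_ hN'
    calc N * (M * (w x + w y)) = N * M * w x + N * M * w y := by ring
      _ ≤ (2 * N + 1) * W := h5
      _ = _ := by field_simp

end Rounding

/-! ### Fractional packing by multiplicative weights -/

section MultiplicativeWeights

open Classical

variable {V : Type*} [Fintype V]

/-- Multiplicative weights: if for all weights some member of a family is light on average, then
boundedly many members of the family form a nearly optimal approximate fractional packing. -/
theorem exists_fractional_packing {Q : Finset V → Prop} {τ M κ δ lam : ℝ} (hτ : 0 < τ)
    (hn : 0 < Fintype.card V) (hM : 0 < M) (hMn : M ≤ Fintype.card V) (hκ : 0 < κ) (hκ1 : κ ≤ 1)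
    (hlam : 0 < lam) (hδ : 0 < δ) (hlδ : lam * δ ≤ κ) (hδM : δ * Fintype.card V ≤ κ * M)
    (hQ : ∀ S, Q S → τ * Fintype.card V ≤ S.card)
    (horacle : ∀ w : V → ℝ, (∀ v, 0 < w v) →
      ∃ S, Q S ∧ M * ∑ v ∈ S, w v ≤ (1 + κ) * S.card * ∑ v, w v) :
    ∃ (T : ℕ) (S : ℕ → Finset V), (∀ i, Q (S i)) ∧ T * (δ * τ) ≤ 1 ∧
      (1 - 4 * κ) * M ≤ δ * ∑ i ∈ Finset.range T, ((S i).card : ℝ) ∧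
      δ * ∑ i ∈ Finset.range T, ((S i).card : ℝ) ≤ M ∧
      ∑ v, max (δ * ((Finset.range T).filter fun i => v ∈ S i).card - 1) 0 ≤
        Fintype.card V / lam := by
  choose! f hfQ hf using horacle
  -- `z k v` is the load of `v` after `k` rounds; each round adds `δ` on the set that the oracle
  -- returns for the weights `exp (lam * z k)`.
  let z : ℕ → V → ℝ := fun k => Nat.rec (fun _ => 0)
    (fun _ y v => y v + if v ∈ f (fun u => Real.exp (lam * y u)) then δ else 0) k
  let S : ℕ → Finset V := fun k => f fun u => Real.exp (lam * z k u)
  have hz : ∀ k v, z (k + 1) v = z k v + if v ∈ S k then δ else 0 := fun k v => rfl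
  have hz' : ∀ k v, z k v = δ * ((Finset.range k).filter fun i => v ∈ S i).card := by
    intro k v
    induction k with
    | zero => simp [z]
    | succ k ih =>
      rw [hz, ih, Finset.range_add_one, Finset.filter_insert]
      split_ifs with h
      · rw [Finset.card_insert_of_notMem (by simp)]
        push_cast
        ring
      · simp
  have hSQ : ∀ k, Q (S k) := fun k => hfQ _ fun v => Real.exp_pos _
  have hSM : ∀ k, M * ∑ v ∈ S k, Real.exp (lam * z k v) ≤
      (1 + κ) * (S k).card * ∑ v, Real.exp (lam * z k v) :=
    fun k => hf _ fun v => Real.exp_pos _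
  set n : ℝ := (Fintype.card V : ℝ) with hndef
  have hn' : 0 < n := by rw [hndef]; exact_mod_cast hn
  let Lo : ℕ → ℝ := fun k => δ * ∑ i ∈ Finset.range k, ((S i).card : ℝ)
  have hLo : ∀ k, Lo (k + 1) = Lo k + δ * (S k).card := by
    intro k
    simp only [Lo, Finset.sum_range_succ]
    ring
  have hLol : ∀ k : ℕ, k * (δ * τ * n) ≤ Lo k := by
    intro k
    induction k with
    | zero => simp [Lo]
    | succ k ih =>
      rw [hLo]
      push_cast
      have : δ * (τ * n) ≤ δ * (S k).card := by gcongr; exact hQ _ (hSQ k)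
      linarith
  -- One factor `1 + κ` comes from the oracle, the other from `exp x - 1 ≤ x (1 + κ)` at `x = lam *
  -- δ ≤ κ`.
  have hΦ : ∀ k, ∑ v, Real.exp (lam * z k v) ≤ n * Real.exp (lam * (1 + κ) ^ 2 * Lo k / M) := by
    intro k
    induction k with
    | zero => simp [z, Lo, hndef]
    | succ k ih =>
      set x := lam * δ with hx
      have hx0 : 0 < x := by positivity
      have hexp : Real.exp x - 1 ≤ x * (1 + κ) := by
        have h := (abs_le.1 (Real.abs_exp_sub_one_sub_id_le
          (x := x) (by rw [abs_of_pos hx0]; linarith))).2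
        nlinarith
      set Φ := ∑ v, Real.exp (lam * z k v) with hΦdef
      have hΦ0 : 0 ≤ Φ := Finset.sum_nonneg fun v _ => (Real.exp_pos _).le
      have h1 : ∑ v, Real.exp (lam * z (k + 1) v) =
          Φ + (Real.exp x - 1) * ∑ v ∈ S k, Real.exp (lam * z k v) := by
        rw [hΦdef, ← Finset.sum_ite_mem_eq (S k), Finset.mul_sum, ← Finset.sum_add_distrib]
        refine Finset.sum_congr rfl fun v _ => ?_
        rw [hz]
        split_ifs
        · rw [mul_add, Real.exp_add]
          ring
        · simp
      have h2 : ∑ v ∈ S k, Real.exp (lam * z k v) ≤ (1 + κ) * (S k).card * Φ / M := by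
        rw [le_div_iff₀ hM, mul_comm]
        exact hSM k
      have h3 : ∑ v, Real.exp (lam * z (k + 1) v) ≤
          Φ * Real.exp (lam * (1 + κ) ^ 2 * (δ * (S k).card) / M) := by
        rw [h1]
        have h4 : (Real.exp x - 1) * ∑ v ∈ S k, Real.exp (lam * z k v) ≤
            (x * (1 + κ)) * ((1 + κ) * (S k).card * Φ / M) := by
          refine mul_le_mul hexp h2 (Finset.sum_nonneg fun v _ => (Real.exp_pos _).le)
            (by positivity)
        have h5 := Real.add_one_le_exp (lam * (1 + κ) ^ 2 * (δ * (S k).card) / M)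
        calc _ ≤ Φ + (x * (1 + κ)) * ((1 + κ) * (S k).card * Φ / M) := by gcongr
          _ = Φ * (lam * (1 + κ) ^ 2 * (δ * (S k).card) / M + 1) := by rw [hx]; ring
          _ ≤ _ := mul_le_mul_of_nonneg_left h5 hΦ0
      refine h3.trans ?_
      rw [hLo, mul_add, add_div, Real.exp_add, ← mul_assoc n]
      exact mul_le_mul_of_nonneg_right ih (Real.exp_pos _).le
  have hex : ∃ k, (1 - 4 * κ) * M ≤ Lo k := by
    obtain ⟨k, hk⟩ := exists_nat_ge (M / (δ * τ * n))
    refine ⟨k, ?_⟩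
    rw [div_le_iff₀ (by positivity)] at hk
    nlinarith [hLol k]
  set T := Nat.find hex with hT
  have hT1 : (1 - 4 * κ) * M ≤ Lo T := Nat.find_spec hex
  -- The last round adds at most `δ n ≤ κ M`. Stopping here makes the potential at most `n exp lam`,
  -- as `(1 + κ)² (1 - 3κ) ≤ 1`. The `0` covers `T = 0`.
  have hT2 : Lo T ≤ max 0 ((1 - 3 * κ) * M) := by
    rcases Nat.eq_zero_or_pos T with h0 | h0
    · have hL0 : Lo 0 = 0 := by simp only [Lo, Finset.range_zero, Finset.sum_empty, mul_zero]
      rw [h0, hL0]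
      exact le_max_left _ _
    · have hlt := Nat.find_min hex (m := T - 1) (by omega)
      have h1 := hLo (T - 1)
      rw [Nat.sub_add_cancel h0] at h1
      have h2 : δ * (S (T - 1)).card ≤ δ * n := by
        gcongr
        exact Nat.cast_le.2 (Finset.card_le_univ _)
      refine le_max_of_le_right ?_
      linarith
  have hT3 : Lo T ≤ M := hT2.trans (max_le hM.le (by nlinarith))
  refine ⟨T, S, hSQ, ?_, hT1, hT3, ?_⟩
  · have h := (hLol T).trans (hT3.trans hMn)
    refine le_of_mul_le_mul_right (a := n) ?_ hn'
    linarith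
  -- The excess over load 1 is bounded by the potential, since `y ≤ exp (lam * y) / lam`.
  · have h1 : ∀ v, max (δ * ((Finset.range T).filter fun i => v ∈ S i).card - 1) 0 ≤
        Real.exp (lam * z T v) * (Real.exp (-lam) / lam) := by
      intro v
      rw [← hz', ← mul_div_assoc, ← Real.exp_add, le_div_iff₀ hlam]
      have := Real.add_one_le_exp (lam * z T v + -lam)
      have := Real.exp_pos (lam * z T v + -lam)
      rcases le_total (z T v - 1) 0 with h | h
      · rw [max_eq_right h]
        linarith
      · rw [max_eq_left h]
        linarith
    have h2 : lam * (1 + κ) ^ 2 * Lo T / M ≤ lam := by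
      rw [div_le_iff₀ hM, mul_assoc]
      gcongr
      refine (mul_le_mul_of_nonneg_left hT2 (by positivity)).trans ?_
      rcases le_total 0 ((1 - 3 * κ) * M) with h | h
      · rw [max_eq_right h, ← mul_assoc]
        refine mul_le_of_le_one_left hM.le ?_
        nlinarith [pow_pos hκ 2, pow_pos hκ 3]
      · rw [max_eq_left h, mul_zero]
        exact hM.le
    calc _ ≤ ∑ v, Real.exp (lam * z T v) * (Real.exp (-lam) / lam) :=
          Finset.sum_le_sum fun v _ => h1 v
      _ = (∑ v, Real.exp (lam * z T v)) * (Real.exp (-lam) / lam) := by rw [Finset.sum_mul]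
      _ ≤ n * Real.exp lam * (Real.exp (-lam) / lam) := by
          gcongr
          refine (hΦ T).trans ?_
          gcongr
      _ = n / lam := by
          rw [mul_assoc, ← mul_div_assoc, ← Real.exp_add]
          simp [div_eq_mul_inv]

end MultiplicativeWeights

/-! ### Splitting overlapping sets into disjoint shares -/

section Shares

open Classical

variable {V : Type*} [Fintype V]

theorem exists_equidistributed_index {V : Type*} (S : Finset V) {q : ℕ} (hq : 0 < q) :
    ∃ idx : V → ℕ, ∀ c < q, (S.card : ℝ) / q - 1 ≤ (S.filter fun v => idx v = c).card := by
  let e := S.equivFin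
  refine ⟨fun v => if h : v ∈ S then (e ⟨v, h⟩).val % q else 0, fun c hc => ?_⟩
  have hlt : ∀ j ∈ Finset.range (S.card / q), j * q + c < S.card := by
    intro j hj
    rw [Finset.mem_range] at hj
    have h1 : (j + 1) * q ≤ S.card / q * q := Nat.mul_le_mul_right _ hj
    have h2 := Nat.div_mul_le_self S.card q
    rw [add_mul] at h1
    omega
  have hle : S.card / q ≤ (S.filter fun v =>
      (if h : v ∈ S then (e ⟨v, h⟩).val % q else 0) = c).card := by
    rw [← Finset.card_range (S.card / q), ← Finset.card_attach]
    refine Finset.card_le_card_of_injOn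
      (fun j => (e.symm ⟨j.1 * q + c, hlt j.1 j.2⟩ : V)) ?_ ?_
    · intro j _
      simp [Nat.mod_eq_of_lt hc]
    · intro j _ k _ h
      have h := e.symm.injective (Subtype.ext h)
      simp only [Fin.mk.injEq, Nat.add_right_cancel_iff] at h
      exact Subtype.ext (Nat.eq_of_mul_eq_mul_right hq h)
  have h1 : (S.card : ℝ) / q - 1 ≤ (S.card / q : ℕ) := by
    have h2 : S.card < (S.card / q + 1) * q := by
      have := Nat.lt_div_mul_add hq (a := S.card)
      rwa [add_mul, one_mul]
    have hq' : (0 : ℝ) < q := by exact_mod_cast hq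
    rw [sub_le_iff_le_add, div_le_iff₀ hq']
    exact_mod_cast h2.le
  exact h1.trans (by exact_mod_cast hle)

/-- Disjoint subsets `Z' i ⊆ Z i` containing about a `1 / q` proportion of `Z i`, up to the number
of vertices that are contained in more than `q` of the sets. -/
theorem exists_disjoint_shares {ι : Type*} [Fintype ι] (Z : ι → Finset V) {q : ℕ} (hq : 0 < q) :
    ∃ (Z' : ι → Finset V) (o : ι → ℝ), (∀ i, Z' i ⊆ Z i) ∧
      (∀ i j, i ≠ j → Disjoint (Z' i) (Z' j)) ∧ (∀ i, 0 ≤ o i) ∧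
      (∀ i, ((Z i).card - o i) / q - 2 ^ Fintype.card ι ≤ ((Z' i).card : ℝ)) ∧
      ∑ i, o i ≤ ∑ v, max (((Finset.univ.filter fun i => v ∈ Z i).card : ℝ) - q) 0 := by
  let e := Fintype.equivFin ι
  -- Within each atom of the set system, vertices are split into `q` nearly equal classes, and class
  -- `c` goes to the set of rank `c` among those containing the atom. Ranks `q` and above get
  -- nothing, which is the overload `o`; rounding costs at most 1 per atom, hence `2 ^ |ι|`.
  let pat : V → Finset ι := fun v => Finset.univ.filter fun i => v ∈ Z i
  let rk : Finset ι → ι → ℕ := fun P i => (P.filter fun j => e j < e i).card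
  have hrk : ∀ P : Finset ι, ∀ i ∈ P, ∀ j ∈ P, e i < e j → rk P i < rk P j := by
    intro P i hi j hj hij
    refine Finset.card_lt_card ⟨fun k hk => ?_, fun h => ?_⟩
    · rw [Finset.mem_filter] at hk ⊢
      exact ⟨hk.1, hk.2.trans hij⟩
    · have := h (Finset.mem_filter.2 ⟨hi, hij⟩)
      simp at this
  have hrki : ∀ P : Finset ι, ∀ i ∈ P, ∀ j ∈ P, rk P i = rk P j → i = j := by
    intro P i hi j hj h
    rcases lt_trichotomy (e i) (e j) with h1 | h1 | h1
    · have := hrk P i hi j hj h1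
      omega
    · exact e.injective h1
    · have := hrk P j hj i hi h1
      omega
  choose idx hidx using fun P : Finset ι =>
    exists_equidistributed_index (Finset.univ.filter fun v => pat v = P) hq
  have hmem : ∀ v i, i ∈ pat v ↔ v ∈ Z i := by simp [pat]
  let Z' : ι → Finset V := fun i => (Z i).filter fun v => idx (pat v) v = rk (pat v) i
  let O : ι → Finset V := fun i => (Z i).filter fun v => q ≤ rk (pat v) i
  refine ⟨Z', fun i => (O i).card, fun i => Finset.filter_subset _ _, ?_, fun i => by positivity,
    ?_, ?_⟩
  · intro i j hij
    rw [Finset.disjoint_left]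
    intro v hv hv'
    simp only [Z', Finset.mem_filter] at hv hv'
    exact hij (hrki _ i ((hmem v i).2 hv.1) j ((hmem v j).2 hv'.1) (hv.2.symm.trans hv'.2))
  · intro i
    have hfib : ∀ U : Finset V, (U.card : ℝ) =
        ∑ P : Finset ι, ((U.filter fun v => pat v = P).card : ℝ) := by
      intro U
      rw [Finset.card_eq_sum_card_fiberwise (f := pat) (t := Finset.univ) (by simp)]
      push_cast
      rfl
    have hq' : (0 : ℝ) < q := by exact_mod_cast hq
    have h2 : (2 : ℝ) ^ Fintype.card ι = ∑ P : Finset ι, (1 : ℝ) := by simp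
    beta_reduce
    rw [hfib (Z' i), hfib (Z i), hfib (O i), h2, ← Finset.sum_sub_distrib, Finset.sum_div,
      ← Finset.sum_sub_distrib]
    refine Finset.sum_le_sum fun P _ => ?_
    by_cases hP : i ∈ P ∧ rk P i < q
    · have h3 : (Z i).filter (fun v => pat v = P) = Finset.univ.filter fun v => pat v = P := by
        ext v
        simp only [Finset.mem_filter, Finset.mem_univ, true_and, and_iff_right_iff_imp]
        rintro rfl
        exact (hmem v i).1 hP.1
      have h4 : (Z' i).filter (fun v => pat v = P) =
          (Finset.univ.filter fun v => pat v = P).filter fun v => idx P v = rk P i := by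
        ext v
        simp only [Z', Finset.mem_filter, Finset.mem_univ, true_and]
        constructor
        · rintro ⟨⟨h, h'⟩, rfl⟩
          exact ⟨rfl, h'⟩
        · rintro ⟨rfl, h⟩
          exact ⟨⟨(hmem v i).1 hP.1, h⟩, rfl⟩
      rw [h3, h4]
      refine le_trans ?_ (hidx P (rk P i) hP.2)
      have : (0 : ℝ) ≤ ((O i).filter fun v => pat v = P).card := Nat.cast_nonneg _
      gcongr
      linarith
    · have h3 : (Z i).filter (fun v => pat v = P) ⊆ (O i).filter fun v => pat v = P := by
        intro v
        simp only [O, Finset.mem_filter]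
        rintro ⟨h, rfl⟩
        refine ⟨⟨h, ?_⟩, rfl⟩
        by_contra! hlt
        exact hP ⟨(hmem v i).2 h, hlt⟩
      have h4 : (((Z i).filter fun v => pat v = P).card : ℝ) ≤
          ((O i).filter fun v => pat v = P).card := by exact_mod_cast Finset.card_le_card h3
      have h5 : ((((Z i).filter fun v => pat v = P).card : ℝ) -
          ((O i).filter fun v => pat v = P).card) / q ≤ 0 :=
        div_nonpos_of_nonpos_of_nonneg (by linarith) hq'.le
      have : (0 : ℝ) ≤ ((Z' i).filter fun v => pat v = P).card := Nat.cast_nonneg _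
      linarith
  · have h1 : ∑ i, ((O i).card : ℝ) =
        ∑ v, (((pat v).filter fun i => q ≤ rk (pat v) i).card : ℝ) := by
      have : ∀ i, ((O i).card : ℝ) = ∑ v, if v ∈ Z i ∧ q ≤ rk (pat v) i then 1 else 0 := by
        intro i
        rw [Finset.sum_boole]
        congr 2
        ext v
        simp [O]
      simp_rw [this]
      rw [Finset.sum_comm]
      refine Finset.sum_congr rfl fun v _ => ?_
      rw [Finset.sum_boole]
      congr 2
      ext i
      simp [pat]
    rw [h1]
    refine Finset.sum_le_sum fun v _ => ?_
    have h2 : ((pat v).filter fun i => q ≤ rk (pat v) i).card ≤ (pat v).card - q := by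
      rw [← Nat.card_Ico]
      refine Finset.card_le_card_of_injOn (rk (pat v)) ?_ ?_
      · intro i hi
        simp only [Finset.coe_filter, Set.mem_ofPred_eq] at hi
        simp only [Finset.coe_Ico, Set.mem_Ico]
        refine ⟨hi.2, Finset.card_lt_card ⟨Finset.filter_subset _ _, fun h => ?_⟩⟩
        have := h hi.1
        simp at this
      · intro i hi j hj h
        simp only [Finset.coe_filter, Set.mem_ofPred_eq] at hi hj
        exact hrki _ i hi.1 j hj.1 h
    rcases le_total q (pat v).card with h | h
    · refine le_max_of_le_left ?_
      have h3 : (((pat v).filter fun i => q ≤ rk (pat v) i).card : ℝ) ≤ ((pat v).card - q : ℕ) := by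
        exact_mod_cast h2
      rwa [Nat.cast_sub h] at h3
    · refine le_max_of_le_right ?_
      have : ((pat v).filter fun i => q ≤ rk (pat v) i).card = 0 := by omega
      rw [this]
      simp

end Shares

/-! ### Cover or path-forest duality -/

section CoverOrPaths

open Classical

theorem IsPseudorandom.edgeCount_le_of_large {V : Type*} [Fintype V] {G : SimpleGraph V}
    {γ p τ : ℝ} (hG : IsPseudorandom G γ p) (hp : 0 ≤ p) (hγτ : γ ≤ τ)
    (hγ : γ ≤ 1 / 8) (hτ : 0 < τ) (hn : 4 / τ ≤ Fintype.card V) (hn8 : 8 ≤ Fintype.card V)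
    (X Y : Finset V) (a b : ℕ) (hX : X.card ≤ a) (hY : Y.card ≤ b)
    (ha : τ * Fintype.card V ≤ a) (hb : τ * Fintype.card V ≤ b) :
    edgeCount G X Y ≤ 32 * p * (a * b) := by
  have hτn : 4 ≤ τ * Fintype.card V := by
    rw [div_le_iff₀ hτ] at hn
    linarith
  have hge : ∀ a : ℕ, τ * Fintype.card V ≤ a → max 1 ⌈γ * (Fintype.card V : ℝ)⌉₊ ≤ a := by
    intro a ha
    refine max_le ?_ (Nat.ceil_le.2 (le_trans (by gcongr) ha))
    have : (1 : ℝ) ≤ a := by linarith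
    exact_mod_cast this
  have hn8' : (8 : ℝ) ≤ Fintype.card V := by exact_mod_cast hn8
  refine hG.edgeCount_le hp (by linarith) (g := max 1 ⌈γ * (Fintype.card V : ℝ)⌉₊) ?_ (by positivity)
    ?_ X Y hX hY (hge a ha) (hge b hb)
  · exact (Nat.le_ceil _).trans (by exact_mod_cast le_max_right _ _)
  · have h1 : ⌈γ * (Fintype.card V : ℝ)⌉₊ ≤ ⌈(Fintype.card V : ℝ) / 8⌉₊ :=
      Nat.ceil_mono (by nlinarith)
    have h2 := Nat.ceil_lt_add_one (by positivity : (0 : ℝ) ≤ (Fintype.card V : ℝ) / 8)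
    have h3 : (4 : ℝ) * ⌈(Fintype.card V : ℝ) / 8⌉₊ < Fintype.card V + 1 := by linarith
    have h4 : 4 * ⌈(Fintype.card V : ℝ) / 8⌉₊ < Fintype.card V + 1 := by exact_mod_cast h3
    omega

theorem exists_paths_of_packing {V : Type*} [Fintype V] {F : SimpleGraph V} {T q : ℕ} {β : ℝ}
    (hq : 0 < q) (hβ : 0 ≤ β) (X Y : Fin T → Finset V) (hXY : ∀ i, Disjoint (X i) (Y i))
    (hc : ∀ i, (X i).card = (Y i).card) (hfull : ∀ i, IsFullPair F (β * (X i).card) (X i) (Y i)) :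
    ∃ l : Fin T → List V, (∀ i, (l i).Nodup) ∧ (∀ i, (l i).IsChain F.Adj) ∧
      (∀ i j, i ≠ j → ∀ v ∈ l i, v ∉ l j) ∧
      (1 / q - 2 * β) * (∑ i, ((X i ∪ Y i).card : ℝ)) - (2 * T * 2 ^ (2 * T) + 6 * T) -
        2 * ∑ v, max (1 / (q : ℝ) * (Finset.univ.filter fun i => v ∈ X i ∪ Y i).card - 1) 0 ≤
      ∑ i, (((l i).length - 1 : ℕ) : ℝ) := by
  have hq' : (0 : ℝ) < q := by exact_mod_cast hq
  -- The two sides of a pair get separate shares, so that both shrink at the same rate and stay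
  -- nearly balanced.
  let Z : Fin T × Bool → Finset V := fun i => if i.2 then X i.1 else Y i.1
  obtain ⟨Z', o, hsub, hdisj, ho, hlow, hsum⟩ := exists_disjoint_shares Z hq
  have hfst : ∀ i, Z' (i, true) ⊆ X i := fun i => hsub (i, true)
  have hsnd : ∀ i, Z' (i, false) ⊆ Y i := fun i => hsub (i, false)
  choose l hnd hch hmem hlen using fun i =>
    (hfull i).exists_path (hfst i) (hsnd i) (hdisj (i, true) (i, false) (by simp))
  refine ⟨l, hnd, hch, ?_, ?_⟩
  · intro i j hij v hv hv'
    have h1 := hmem i v hv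
    have h2 := hmem j v hv'
    rw [Finset.mem_union] at h1 h2
    rcases h1 with h1 | h1 <;> rcases h2 with h2 | h2 <;>
      exact Finset.disjoint_left.1 (hdisj _ _ (by simp [hij])) h1 h2
  have hcard : Fintype.card (Fin T × Bool) = 2 * T := by
    simp [mul_comm]
  rw [hcard] at hlow
  -- The 6 is 4 for the ceiling in the search, 1 for its additive loss, and 1 for counting edges
  -- instead of vertices.
  have hi : ∀ i, (1 / q - 2 * β) * ((X i ∪ Y i).card : ℝ) - (2 * 2 ^ (2 * T) + 6) -
      2 / q * (o (i, true) + o (i, false)) ≤ (((l i).length - 1 : ℕ) : ℝ) := by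
    intro i
    have hu : ((X i ∪ Y i).card : ℝ) = 2 * (X i).card := by
      rw [Finset.card_union_of_disjoint (hXY i), ← hc i]
      push_cast
      ring
    have h1 := hlow (i, true)
    have h2 := hlow (i, false)
    simp only [Z, if_true, Bool.false_eq_true, if_false] at h1 h2
    rw [← hc i] at h2
    have h3 : (2 : ℝ) * (min (Z' (i, true)).card (Z' (i, false)).card : ℕ) ≤
        (l i).length + 4 * ⌈β * (X i).card⌉₊ + 1 := by exact_mod_cast hlen i
    have h4 := Nat.ceil_lt_add_one (by positivity : 0 ≤ β * ((X i).card : ℝ))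
    have h5 : ((l i).length : ℝ) ≤ ((l i).length - 1 : ℕ) + 1 := by
      have : (l i).length ≤ (l i).length - 1 + 1 := by omega
      exact_mod_cast this
    have h6 : ((X i).card - (o (i, true) + o (i, false))) / q - 2 ^ (2 * T) ≤
        ((min (Z' (i, true)).card (Z' (i, false)).card : ℕ) : ℝ) := by
      rw [Nat.cast_min]
      have a1 : ((X i).card - (o (i, true) + o (i, false))) / q ≤
          ((X i).card - o (i, true)) / q := by
        gcongr
        linarith [ho (i, false)]
      have a2 : ((X i).card - (o (i, true) + o (i, false))) / q ≤
          ((X i).card - o (i, false)) / q := by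
        gcongr
        linarith [ho (i, true)]
      exact le_min (by linarith) (by linarith)
    have h7 : 2 * (((X i).card - (o (i, true) + o (i, false))) / q) =
        1 / q * (2 * (X i).card) - 2 / q * (o (i, true) + o (i, false)) := by ring
    rw [hu]
    linarith
  have hover : ∑ i, (o (i, true) + o (i, false)) ≤ q * ∑ v, max (1 / (q : ℝ) *
      (Finset.univ.filter fun i => v ∈ X i ∪ Y i).card - 1) 0 := by
    have h1 : ∑ i, o i = ∑ i, (o (i, true) + o (i, false)) := by
      rw [Fintype.sum_prod_type]
      simp
    rw [← h1, Finset.mul_sum]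
    refine hsum.trans (Finset.sum_le_sum fun v _ => ?_)
    have h2 : (Finset.univ.filter fun i => v ∈ Z i).card ≤
        (Finset.univ.filter fun i => v ∈ X i ∪ Y i).card := by
      refine Finset.card_le_card_of_injOn Prod.fst ?_ ?_
      · rintro ⟨i, b⟩ h
        simp only [Z, Finset.coe_filter, Finset.mem_univ, true_and, Set.mem_ofPred_eq,
          Finset.mem_union] at h ⊢
        cases b <;> simp at h <;> tauto
      · rintro ⟨i, b⟩ h ⟨j, b'⟩ h' hij
        obtain rfl : i = j := hij
        simp only [Z, Finset.coe_filter, Finset.mem_univ, true_and, Set.mem_ofPred_eq] at h h'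
        have : v ∈ X i → v ∉ Y i := fun h => Finset.disjoint_left.1 (hXY i) h
        cases b <;> cases b' <;> simp at h h' ⊢ <;> tauto
    rw [mul_max_of_nonneg _ _ hq'.le, mul_zero, mul_sub, ← mul_assoc, mul_one_div_cancel hq'.ne',
      one_mul, mul_one]
    gcongr
  calc _ ≤ (1 / q - 2 * β) * (∑ i, ((X i ∪ Y i).card : ℝ)) - (2 * T * 2 ^ (2 * T) + 6 * T) -
        2 / q * ∑ i, (o (i, true) + o (i, false)) := by
          have h := mul_le_mul_of_nonneg_left hover (by positivity : 0 ≤ 2 / (q : ℝ))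
          rw [← mul_assoc, div_mul_cancel₀ _ hq'.ne'] at h
          linarith
    _ = ∑ i, ((1 / q - 2 * β) * ((X i ∪ Y i).card : ℝ) - (2 * 2 ^ (2 * T) + 6) -
      2 / q * (o (i, true) + o (i, false))) := by
          rw [Finset.sum_sub_distrib, Finset.sum_sub_distrib, ← Finset.mul_sum, ← Finset.mul_sum]
          simp
          ring
    _ ≤ _ := Finset.sum_le_sum fun i _ => hi i

/-- In a pseudorandom graph, a subgraph has either an approximate half-integral vertex cover of
small weight or a large linear forest with boundedly many paths. -/
theorem exists_cover_or_paths {c κ η : ℝ} (hc : 0 < c) (hκ : 0 < κ) (hκ1 : κ ≤ 1)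
    (hη : 0 < η) :
    ∃ (T₀ : ℕ) (γ₀ : ℝ) (n₀ : ℕ), 0 < γ₀ ∧ ∀ (V : Type*) [Fintype V] (G F : SimpleGraph V)
      (γ p M : ℝ), 0 < p → γ ≤ γ₀ → IsPseudorandom G γ p → n₀ ≤ Fintype.card V → F ≤ G →
      c * Fintype.card V ≤ M → M ≤ Fintype.card V →
      (∃ A B : Finset V, Disjoint A B ∧ 2 * (A.card : ℝ) + B.card ≤ M ∧
        edgeCount (F.uncovered A B) Finset.univ Finset.univ ≤
          η * p * (Fintype.card V : ℝ) ^ 2) ∨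
      (∃ T ≤ T₀, ∃ l : Fin T → List V, (∀ i, (l i).Nodup) ∧ (∀ i, (l i).IsChain F.Adj) ∧
        (∀ i j, i ≠ j → ∀ v ∈ l i, v ∉ l j) ∧
        (1 - 8 * κ) * M ≤ ∑ i, (((l i).length - 1 : ℕ) : ℝ)) := by
  -- `1 / q` is the step size `δ` of the packing; this choice yields both `lam * δ ≤ κ` and `δ n ≤ κ
  -- M` for `lam = 1 / (κ c)`.
  obtain ⟨q, hq⟩ := exists_nat_ge (1 / (κ ^ 2 * c))
  have hq0 : (0 : ℝ) < q := lt_of_lt_of_le (by positivity) hq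
  have hq0' : 0 < q := by exact_mod_cast hq0
  have hq1 : (1 : ℝ) ≤ q := by exact_mod_cast hq0'
  obtain ⟨N, hN⟩ := exists_nat_ge (1 / κ)
  have hN0 : (0 : ℝ) < N := lt_of_lt_of_le (by positivity) hN
  -- Shares keep only a `1 / q` proportion of a pair, so fullness must hold at a scale well below
  -- that.
  set β : ℝ := κ / (4 * q) with hβdef
  have hβ0 : 0 < β := by positivity
  have hβ1 : β ≤ 1 / 4 := by
    rw [hβdef, div_le_div_iff₀ (by positivity) (by positivity)]
    nlinarith
  obtain ⟨τ, hτ0, hτ1, hτ⟩ := exists_isFullPair hβ0 hβ1 (by positivity : 0 < η / 2)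
  obtain ⟨T₀, hT₀⟩ := exists_nat_ge (q / τ)
  obtain ⟨n₁, hn₁⟩ := exists_nat_ge (4 / τ)
  obtain ⟨n₂, hn₂⟩ := exists_nat_ge ((2 * T₀ * 2 ^ (2 * T₀) + 6 * T₀) / (κ * c))
  refine ⟨T₀, min τ (1 / 8), max 8 (max n₁ n₂), by positivity, ?_⟩
  intro V _ G F γ p M hp hγ hG hn hFG hM hMn
  have hn8 : 8 ≤ Fintype.card V := (le_max_left _ _).trans hn
  have hnτ : 4 / τ ≤ Fintype.card V :=
    hn₁.trans (Nat.cast_le.2 ((le_max_left _ _).trans ((le_max_right _ _).trans hn)))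
  have hnT : (2 * T₀ * 2 ^ (2 * T₀) + 6 * T₀) / (κ * c) ≤ Fintype.card V :=
    hn₂.trans (Nat.cast_le.2 ((le_max_right _ _).trans ((le_max_right _ _).trans hn)))
  have hn0 : (0 : ℝ) < Fintype.card V := by
    have : 0 < Fintype.card V := by omega
    exact_mod_cast this
  have hne : Nonempty V := Fintype.card_pos_iff.1 (by omega)
  have hM0 : 0 < M := lt_of_lt_of_le (by positivity) hM
  rw [or_iff_not_imp_left]
  intro hcov
  push Not at hcov
  have hU := hG.edgeCount_le_of_large hp.le (hγ.trans (min_le_left _ _))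
    (hγ.trans (min_le_right _ _)) hτ0 hnτ hn8
  let Q : Finset V → Prop := fun S => ∃ X Y, S = X ∪ Y ∧ Disjoint X Y ∧ X.card = Y.card ∧
    τ * Fintype.card V ≤ X.card ∧ IsFullPair F (β * X.card) X Y
  have hlam : (0 : ℝ) < 1 / (κ * c) := by positivity
  have hqc : 1 / (q : ℝ) ≤ κ ^ 2 * c := by
    rw [div_le_iff₀ (by positivity)] at hq
    rw [div_le_iff₀ hq0]
    linarith
  obtain ⟨T, S, hSQ, hT, hlow, hup, hover⟩ := exists_fractional_packing (Q := Q) (τ := τ) (M := M)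
    (κ := κ) (δ := 1 / q) (lam := 1 / (κ * c)) hτ0 (by omega) hM0 hMn hκ hκ1 hlam (by positivity)
    (by
      rw [div_mul_eq_mul_div, one_mul, div_le_iff₀ (by positivity)]
      calc _ ≤ _ := hqc
        _ = _ := by ring)
    (by
      calc 1 / (q : ℝ) * Fintype.card V ≤ κ ^ 2 * c * Fintype.card V := by gcongr
        _ = κ * (κ * (c * Fintype.card V)) := by ring
        _ ≤ κ * (1 * M) := by gcongr
        _ = _ := by ring)
    (by
      rintro _ ⟨X, Y, rfl, hd, -, hX, -⟩
      refine hX.trans ?_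
      exact_mod_cast Finset.card_le_card Finset.subset_union_left)
    (by
      intro w hw
      obtain ⟨X₀, Y₀, h0, hb⟩ := exists_light_dense_pair hM0 (N := N) (by exact_mod_cast hN0)
        hcov w hw
      obtain ⟨X, hX, Y, hY, hd, hXY, hXc, hfull⟩ := hτ V F p hp hnτ
        (fun A B a b h1 h2 h3 h4 =>
          (edgeCount_mono hFG subset_rfl subset_rfl).trans (hU A B a b h1 h2 h3 h4))
        X₀ Y₀ (by linarith)
      refine ⟨X ∪ Y, ⟨X, Y, rfl, hd, hXY, hXc, hfull⟩, ?_⟩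
      have hX0 : 0 < X.card := by
        have : (0 : ℝ) < X.card := lt_of_lt_of_le (by positivity) hXc
        exact_mod_cast this
      have h1 := sum_union_le_of_add_le hd hXY hX0 (w := fun v => M * w v)
        (b := (2 + 1 / N) * ∑ v, w v) (fun x hx y hy => by
          have := hb x (hX hx) y (hY hy)
          linarith)
      rw [← Finset.mul_sum] at h1
      have h2 : 1 / (N : ℝ) ≤ κ := by
        rw [div_le_iff₀ hκ] at hN
        rw [div_le_iff₀ hN0]
        linarith
      have h3 : ((X ∪ Y).card : ℝ) = 2 * X.card := by
        rw [Finset.card_union_of_disjoint hd, ← hXY]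
        push_cast
        ring
      have hW : 0 ≤ ∑ v, w v := Finset.sum_nonneg fun v _ => (hw v).le
      rw [h3]
      calc _ ≤ _ := h1
        _ ≤ X.card * ((2 + 2 * κ) * ∑ v, w v) := by
          gcongr
          linarith
        _ = _ := by ring)
  choose X Y hS hd hXY hXc hfull using hSQ
  have hTT₀ : T ≤ T₀ := by
    have h1 : (T : ℝ) ≤ q / τ := by
      rw [le_div_iff₀ hτ0]
      have := mul_le_mul_of_nonneg_left hT hq0.le
      field_simp at this
      linarith
    exact_mod_cast h1.trans hT₀
  obtain ⟨l, hnd, hch, hdis, hlen⟩ := exists_paths_of_packing hq0' hβ0.le (fun i : Fin T => X i)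
    (fun i => Y i) (fun i => hd i) (fun i => hXY i) (fun i => hfull i)
  refine ⟨T, hTT₀, l, hnd, hch, hdis, ?_⟩
  refine le_trans ?_ hlen
  have hs : ∑ i : Fin T, ((X i ∪ Y i).card : ℝ) = ∑ i ∈ Finset.range T, ((S i).card : ℝ) := by
    rw [← Fin.sum_univ_eq_sum_range (fun i => ((S i).card : ℝ))]
    exact Finset.sum_congr rfl fun i _ => by rw [hS]
  have ho : ∀ v, (Finset.univ.filter fun i : Fin T => v ∈ X i ∪ Y i).card =
      ((Finset.range T).filter fun i => v ∈ S i).card := by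
    intro v
    rw [Finset.card_filter, Finset.card_filter,
      ← Fin.sum_univ_eq_sum_range (fun i => if v ∈ S i then 1 else 0)]
    exact Finset.sum_congr rfl fun i _ => by rw [hS]
  simp only [hs, ho]
  have hloss : 2 * (T : ℝ) * 2 ^ (2 * T) + 6 * T ≤ κ * M := by
    have h1 : (T : ℝ) ≤ T₀ := by exact_mod_cast hTT₀
    have h2 : (2 : ℝ) ^ (2 * T) ≤ 2 ^ (2 * T₀) := pow_le_pow_right₀ (by norm_num) (by omega)
    calc _ ≤ 2 * (T₀ : ℝ) * 2 ^ (2 * T₀) + 6 * T₀ := by gcongr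
      _ ≤ κ * (c * Fintype.card V) := by
        rw [div_le_iff₀ (by positivity)] at hnT
        linarith
      _ ≤ _ := by gcongr
  have hover' : (Fintype.card V : ℝ) / (1 / (κ * c)) ≤ κ * M := by
    rw [div_div_eq_mul_div, div_one]
    calc _ = κ * (c * Fintype.card V) := by ring
      _ ≤ _ := by gcongr
  set total := ∑ i ∈ Finset.range T, ((S i).card : ℝ)
  have hβs : 2 * β * total = κ / 2 * (1 / q * total) := by
    rw [hβdef]
    field_simp
    ring
  have hβs' : κ / 2 * (1 / q * total) ≤ κ / 2 * M := by gcongr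
  rw [sub_mul _ _ total, hβs]
  -- Losses in units of `κ M`: 4 from the packing, 1/2 from `β`, 1 from rounding and 2 from
  -- overload.
  linarith [mul_pos hκ hM0]

end CoverOrPaths

/-! ### Small covers in all colours are impossible -/

section Covers

open Classical

variable {V : Type*} [Fintype V]

/-- Two indices reaching `x` would average to at most `a + (∑ b) / 2`. -/
theorem exists_common_index {r : ℕ} (hr : 0 < r) (a x : ℝ) (b : Fin r → ℝ) (hb : ∀ i, 0 ≤ b i)
    (hx : a + (∑ i, b i) / 2 < x) :
    ∃ i₀, ∀ i, x ≤ a + b i → i = i₀ := by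
  by_cases h : ∃ i₀, x ≤ a + b i₀
  · obtain ⟨i₀, h0⟩ := h
    refine ⟨i₀, fun i hi => ?_⟩
    by_contra hne
    have h1 : b i + b i₀ ≤ ∑ j, b j := by
      rw [← Finset.sum_pair hne]
      exact Finset.sum_le_sum_of_subset_of_nonneg (Finset.subset_univ _) fun j _ _ => hb j
    linarith
  · push Not at h
    exact ⟨⟨0, hr⟩, fun i hi => absurd hi (not_le.2 (h i))⟩

/-- A system of half-integral covers in which every good vertex is covered in a robust way has
large total weight. -/
theorem not_small_covers {r : ℕ} (hr : 0 < r) {α ε θ M : ℝ} (A B : Fin r → Finset V)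
    (Good : Finset V) (hn : 0 < Fintype.card V) (hε : 0 < ε) (hα1 : α ≤ 1)
    (hθ : θ < ε * α / 2) (hcard : ∀ i, 2 * ((A i).card : ℝ) + (B i).card ≤ M)
    (hM1 : r * M ≤ (1 - ε / 2) * (2 * α * Fintype.card V))
    (hM2 : (r + 1) * M ≤ (1 - ε / 2) * (2 * Fintype.card V))
    (hGood : (1 - θ) * Fintype.card V ≤ Good.card)
    (hdeg : ∀ v ∈ Good, v ∉ Finset.univ.biUnion A → ∀ U : Finset V,
      (U = Finset.univ.biUnion A ∨ ∃ i, U = Finset.univ.biUnion A ∪ B i) →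
      (∀ i, v ∈ B i → B i ⊆ U) → (α - θ) * Fintype.card V ≤ U.card) : False := by
  set n : ℝ := (Fintype.card V : ℝ) with hndef
  have hn0 : 0 < n := by rw [hndef]; exact_mod_cast hn
  set U₀ := Finset.univ.biUnion A
  set a : ℝ := ∑ i, ((A i).card : ℝ) with ha
  have hU₀ : (U₀.card : ℝ) ≤ a := by
    rw [ha]
    exact_mod_cast Finset.card_biUnion_le
  have hsum : 2 * a + ∑ i, ((B i).card : ℝ) ≤ r * M := by
    rw [ha, Finset.mul_sum, ← Finset.sum_add_distrib]
    refine (Finset.sum_le_sum fun i _ => hcard i).trans ?_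
    simp
  have hBnn : 0 ≤ ∑ i, ((B i).card : ℝ) := Finset.sum_nonneg fun i _ => Nat.cast_nonneg _
  have hlt : a + (∑ i, ((B i).card : ℝ)) / 2 < (α - θ) * n := by nlinarith
  obtain ⟨i₀, hi₀⟩ := exists_common_index hr a _ (fun i => ((B i).card : ℝ))
    (fun i => Nat.cast_nonneg _) hlt
  -- A good vertex outside `U₀` and `B i₀` lies in at least two other `B j`: with at most one, the
  -- degree condition would force that index to be `i₀`, or `U₀` alone to be too large.
  have hkey : ∀ v ∈ Good, (1 : ℝ) ≤ (if v ∈ U₀ then 1 else 0) + (if v ∈ B i₀ then 1 else 0) +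
      (∑ j ∈ Finset.univ.erase i₀, if v ∈ B j then (1 : ℝ) else 0) / 2 := by
    intro v hv
    have hs0 : 0 ≤ ∑ j ∈ Finset.univ.erase i₀, if v ∈ B j then (1 : ℝ) else 0 :=
      Finset.sum_nonneg fun j _ => by split_ifs <;> norm_num
    by_cases hvU : v ∈ U₀
    · rw [if_pos hvU]
      split_ifs <;> linarith
    by_cases hvB : v ∈ B i₀
    · rw [if_neg hvU, if_pos hvB]
      linarith
    rw [if_neg hvU, if_neg hvB, Finset.sum_boole]
    have htwo : 2 ≤ ((Finset.univ.erase i₀).filter fun j => v ∈ B j).card := by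
      by_contra! hlt2
      have hle : ((Finset.univ.erase i₀).filter fun j => v ∈ B j).card ≤ 1 := by omega
      rw [Finset.card_le_one] at hle
      have hmem : ∀ j, v ∈ B j → j ∈ (Finset.univ.erase i₀).filter fun j => v ∈ B j := by
        intro j hj
        have : j ≠ i₀ := by
          rintro rfl
          exact hvB hj
        simp [this, hj]
      by_cases hex : ∃ i, v ∈ B i
      · obtain ⟨i, hi⟩ := hex
        have h1 := hdeg v hv hvU (U₀ ∪ B i) (Or.inr ⟨i, rfl⟩) (fun j hj => by
          rw [hle j (hmem j hj) i (hmem i hi)]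
          exact Finset.subset_union_right)
        have h2 : ((U₀ ∪ B i).card : ℝ) ≤ U₀.card + (B i).card := by
          exact_mod_cast Finset.card_union_le _ _
        have h3 := hi₀ i (by linarith)
        rw [h3] at hi
        exact hvB hi
      · push Not at hex
        have h1 := hdeg v hv hvU U₀ (Or.inl rfl) fun j hj => absurd hj (hex j)
        linarith
    have htwo' : (2 : ℝ) ≤ ((Finset.univ.erase i₀).filter fun j => v ∈ B j).card := by
      exact_mod_cast htwo
    linarith
  have hind : ∀ U : Finset V, ∑ v ∈ Good, (if v ∈ U then (1 : ℝ) else 0) ≤ U.card := by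
    intro U
    rw [Finset.sum_boole]
    refine Nat.cast_le.2 (Finset.card_le_card fun v hv => (Finset.mem_filter.1 hv).2)
  have hcount : (Good.card : ℝ) ≤ a + (B i₀).card +
      (∑ j ∈ Finset.univ.erase i₀, ((B j).card : ℝ)) / 2 := by
    calc (Good.card : ℝ) = ∑ v ∈ Good, (1 : ℝ) := by simp
      _ ≤ _ := Finset.sum_le_sum hkey
      _ = ∑ v ∈ Good, (if v ∈ U₀ then (1 : ℝ) else 0) +
            ∑ v ∈ Good, (if v ∈ B i₀ then (1 : ℝ) else 0) +
            (∑ j ∈ Finset.univ.erase i₀, ∑ v ∈ Good, if v ∈ B j then (1 : ℝ) else 0) / 2 := by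
          rw [Finset.sum_add_distrib, Finset.sum_add_distrib, ← Finset.sum_div, Finset.sum_comm]
      _ ≤ _ := by
          have h1 := (hind U₀).trans hU₀
          have h2 := hind (B i₀)
          have h3 : (∑ j ∈ Finset.univ.erase i₀, ∑ v ∈ Good, if v ∈ B j then (1 : ℝ) else 0) ≤
              ∑ j ∈ Finset.univ.erase i₀, ((B j).card : ℝ) := Finset.sum_le_sum fun j _ => hind _
          linarith
  have hBs : ∑ j ∈ Finset.univ.erase i₀, ((B j).card : ℝ) + (B i₀).card =
      ∑ i, ((B i).card : ℝ) := Finset.sum_erase_add _ _ (Finset.mem_univ _)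
  have hi₀M : ((B i₀).card : ℝ) ≤ M := by
    have := hcard i₀
    have : (0 : ℝ) ≤ (A i₀).card := Nat.cast_nonneg _
    linarith
  have hfin : (1 - θ) * n ≤ (1 - ε / 2) * n := by linarith
  have := le_of_mul_le_mul_right hfin hn0
  nlinarith

theorem edgeCount_singleton {V : Type*} (F : SimpleGraph V) (v : V) (Y : Finset V) :
    edgeCount F {v} Y = ∑ y ∈ Y, if F.Adj v y then (1 : ℝ) else 0 := by
  simp [edgeCount]

theorem card_filter_lt_mul_le {f : V → ℝ} (hf : ∀ v, 0 ≤ f v) {x : ℝ} :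
    ((Finset.univ.filter fun v => x < f v).card : ℝ) * x ≤ ∑ v, f v := by
  rw [← nsmul_eq_mul]
  exact (Finset.card_nsmul_le_sum _ f x fun v hv => ((Finset.mem_filter.1 hv).2).le).trans
    (Finset.sum_le_sum_of_subset_of_nonneg (Finset.subset_univ _) fun v _ _ => hf v)

/-- Supplies the degree condition of `not_small_covers` with `θ = (2r + 2) σ`: outside `2r + 2`
exceptional sets of size at most `σn`, a vertex has typical `G`-degrees and few uncovered edges, so
its `H`-neighbours nearly all lie in `U`. The bound `σ²` lets Markov's inequality give `σn`. -/
theorem not_covers_of_isPseudorandom {r : ℕ} (hr : 0 < r) {G H : SimpleGraph V}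
    {α ε σ M γ p : ℝ} (hn : 200 / σ ≤ Fintype.card V) (hε : 0 < ε) (hα : 0 < α) (hα1 : α ≤ 1)
    (hσ : 0 < σ) (hσ1 : σ ≤ 1) (hσε : (2 * r + 2) * σ < ε * α / 2) (hp : 0 < p) (hγ0 : 0 ≤ γ)
    (hγ : γ ≤ σ / 200) (hG : IsPseudorandom G γ p) (F : Fin r → SimpleGraph V) (hHG : H ≤ G)
    (hF : ∀ u v, H.Adj u v → ∃ i, (F i).Adj u v)
    (hres : ∀ v, α * edgeCount G {v} Finset.univ ≤ edgeCount H {v} Finset.univ)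
    (hM1 : r * M ≤ (1 - ε / 2) * (2 * α * Fintype.card V))
    (hM2 : (r + 1) * M ≤ (1 - ε / 2) * (2 * Fintype.card V))
    (hcov : ∀ i, ∃ A B : Finset V, Disjoint A B ∧ 2 * (A.card : ℝ) + B.card ≤ M ∧
        edgeCount ((F i).uncovered A B) Finset.univ Finset.univ ≤
          σ ^ 2 * p * (Fintype.card V : ℝ) ^ 2) : False := by
  choose A B _ hcard hunc using hcov
  set n : ℝ := (Fintype.card V : ℝ) with hndef
  have hn0 : 0 < n := lt_of_lt_of_le (by positivity) hn
  have hn0' : 0 < Fintype.card V := by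
    have : (0 : ℝ) < (Fintype.card V : ℝ) := hn0
    exact_mod_cast this
  set U₀ := Finset.univ.biUnion A with hU₀
  let large : Finset V → Finset V := fun U =>
    Finset.univ.filter fun v => p * (U.card + σ * n) < edgeCount G {v} U
  let small : Finset V := Finset.univ.filter fun v =>
    edgeCount G {v} Finset.univ < p * ((1 - σ) * n)
  let unc : Fin r → Finset V := fun i => Finset.univ.filter fun v =>
    σ * p * n < edgeCount ((F i).uncovered (A i) (B i)) {v} Finset.univ
  have hlarge : ∀ U, ((large U).card : ℝ) ≤ σ * n := fun U =>
    hG.card_large_degree_le hp hσ hσ1 hγ0 hγ hn U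
  have hsmall : (small.card : ℝ) ≤ σ * n := hG.card_small_degree_le hp hσ hσ1 hγ0 hγ hn
  have huncc : ∀ i, ((unc i).card : ℝ) ≤ σ * n := by
    intro i
    have h1 := card_filter_lt_mul_le (f := fun v =>
      edgeCount ((F i).uncovered (A i) (B i)) {v} Finset.univ) (x := σ * p * n)
      (fun v => edgeCount_nonneg _ _ _)
    rw [sum_edgeCount_singleton] at h1
    refine le_of_mul_le_mul_right (h1.trans ((hunc i).trans (le_of_eq ?_)))
      (by positivity : 0 < σ * p * n)
    ring
  let bad : Finset V := small ∪ large U₀ ∪ Finset.univ.biUnion (fun i => large (U₀ ∪ B i)) ∪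
    Finset.univ.biUnion unc
  have hbad : (bad.card : ℝ) ≤ (2 * r + 2) * σ * n := by
    have h1 : bad.card ≤ small.card + (large U₀).card + ∑ i, (large (U₀ ∪ B i)).card +
        ∑ i, (unc i).card := by
      refine (Finset.card_union_le _ _).trans (add_le_add ?_ Finset.card_biUnion_le)
      refine (Finset.card_union_le _ _).trans (add_le_add ?_ Finset.card_biUnion_le)
      exact Finset.card_union_le _ _
    have h2 : (bad.card : ℝ) ≤ small.card + (large U₀).card +
        ∑ i, ((large (U₀ ∪ B i)).card : ℝ) + ∑ i, ((unc i).card : ℝ) := by exact_mod_cast h1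
    have h3 : ∑ i, ((large (U₀ ∪ B i)).card : ℝ) ≤ ∑ i : Fin r, σ * n :=
      Finset.sum_le_sum fun i _ => hlarge _
    have h4 : ∑ i, ((unc i).card : ℝ) ≤ ∑ i : Fin r, σ * n :=
      Finset.sum_le_sum fun i _ => huncc _
    simp only [Finset.sum_const, Finset.card_univ, Fintype.card_fin, nsmul_eq_mul] at h3 h4
    have h5 := hlarge U₀
    linarith
  refine not_small_covers hr A B badᶜ hn0' hε hα1 hσε hcard hM1 hM2 ?_ ?_
  · rw [Finset.card_compl, Nat.cast_sub (Finset.card_le_univ _)]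
    linarith
  · intro v hv hvU U hU hvB
    simp only [bad, Finset.mem_compl, Finset.mem_union, Finset.mem_biUnion, Finset.mem_univ,
      true_and, not_or, not_exists] at hv
    obtain ⟨⟨⟨h1, h2⟩, h3⟩, h4⟩ := hv
    have hvlarge : v ∉ large U := by
      rcases hU with rfl | ⟨i, rfl⟩
      · exact h2
      · exact h3 i
    simp only [large, small, unc, Finset.mem_filter, Finset.mem_univ, true_and, not_lt]
      at h1 hvlarge h4
    have hU₀U : U₀ ⊆ U := by
      rcases hU with rfl | ⟨i, rfl⟩
      · exact subset_rfl
      · exact Finset.subset_union_left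
    have hdeg : edgeCount H {v} Finset.univ ≤
        edgeCount G {v} U + ∑ i, edgeCount ((F i).uncovered (A i) (B i)) {v} Finset.univ := by
      simp only [edgeCount_singleton]
      rw [← Finset.sum_ite_mem_eq U, Finset.sum_comm, ← Finset.sum_add_distrib]
      refine Finset.sum_le_sum fun u _ => ?_
      have hnn : ∀ i, (0 : ℝ) ≤ if ((F i).uncovered (A i) (B i)).Adj v u then 1 else 0 := by
        intro i
        split_ifs <;> norm_num
      have hsnn := Finset.sum_nonneg fun i (_ : i ∈ Finset.univ) => hnn i
      by_cases hadj : H.Adj v u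
      · rw [if_pos hadj]
        by_cases huU : u ∈ U
        · rw [if_pos huU, if_pos (hHG hadj)]
          linarith
        · obtain ⟨i, hi⟩ := hF v u hadj
          have hvA : v ∉ A i := fun h => hvU (Finset.mem_biUnion.2 ⟨i, Finset.mem_univ _, h⟩)
          have huA : u ∉ A i := fun h =>
            huU (hU₀U (Finset.mem_biUnion.2 ⟨i, Finset.mem_univ _, h⟩))
          have hB : ¬ (v ∈ B i ∧ u ∈ B i) := fun h => huU (hvB i h.1 h.2)
          have h5 := Finset.single_le_sum (fun i _ => hnn i) (Finset.mem_univ i)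
          have h6 : ((F i).uncovered (A i) (B i)).Adj v u := ⟨hi, hvA, huA, hB⟩
          rw [if_pos h6] at h5
          rw [if_neg huU]
          linarith
      · rw [if_neg hadj]
        refine add_nonneg ?_ hsnn
        split_ifs <;> norm_num
    have hsum : ∑ i, edgeCount ((F i).uncovered (A i) (B i)) {v} Finset.univ ≤
        r * (σ * p * n) := by
      refine (Finset.sum_le_sum fun i _ => h4 i).trans ?_
      simp
    have h5 : α * (p * ((1 - σ) * n)) ≤ p * (U.card + σ * n) + r * (σ * p * n) :=
      (mul_le_mul_of_nonneg_left h1 hα.le).trans ((hres v).trans (by linarith))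
    have h6 : p * (α * ((1 - σ) * n)) ≤ p * (U.card + σ * n + r * (σ * n)) := by linarith
    have h7 := le_of_mul_le_mul_left h6 hp
    have h8 : α * (σ * n) ≤ 1 * (σ * n) := by gcongr
    have h9 : 0 ≤ (r : ℝ) * (σ * n) := by positivity
    linarith

end Covers

/-! ### Colour classes, parameters and hierarchy bounds -/

section Main

open Classical

theorem edgeCount_singleton_univ {V : Type*} [Fintype V] (F : SimpleGraph V) (v : V) :
    edgeCount F {v} Finset.univ = ((F.neighborSet v).ncard : ℝ) := by
  rw [edgeCount_singleton, Finset.sum_boole, Set.ncard_eq_toFinset_card']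
  congr 2
  ext u
  simp

/-- The spanning graph formed by the edges of `H` with colour `k`. -/
def colourGraph {V : Type*} {G : SimpleGraph V} {H : G.Subgraph} {r : ℕ}
    (c : H.edgeSet → Fin r) (k : Fin r) : SimpleGraph V :=
  SimpleGraph.fromEdgeSet {e | ∃ h : e ∈ H.edgeSet, c ⟨e, h⟩ = k}

theorem colourGraph_adj_le {V : Type*} {G : SimpleGraph V} {H : G.Subgraph} {r : ℕ}
    {c : H.edgeSet → Fin r} {k : Fin r} {u v : V} (h : (colourGraph c k).Adj u v) : H.Adj u v := by
  rw [colourGraph, SimpleGraph.fromEdgeSet_adj] at h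
  exact h.1.1

theorem exists_linearForest_of_lists {V : Type*} [Fintype V] {G : SimpleGraph V} {H : G.Subgraph}
    (hH : H.IsSpanning) {r : ℕ} (c : H.edgeSet → Fin r) (k : Fin r) {T : ℕ} (l : Fin T → List V)
    (hnd : ∀ i, (l i).Nodup) (hch : ∀ i, (l i).IsChain (colourGraph c k).Adj)
    (hdis : ∀ i j, i ≠ j → ∀ v ∈ l i, v ∉ l j) :
    ∃ F : G.Subgraph, F ≤ H ∧ IsLinearForest F.coe ∧
      (∀ e : H.edgeSet, e.1 ∈ F.edgeSet → c e = k) ∧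
      ∑ i, ((l i).length - 1) ≤ F.edgeSet.ncard ∧ Nat.card F.coe.ConnectedComponent ≤ T := by
  obtain ⟨F, h1, h2, h3, h4, h5⟩ := exists_linearForest_subgraph (L := fun i => (l i).length) H
    (colourGraph c k).Adj (fun x => (l x.1).get x.2) (by
      rintro ⟨i, a⟩ ⟨j, b⟩ h
      simp only at h
      have hij : i = j := by
        by_contra hij
        exact hdis i j hij _ (List.get_mem _ a) (h ▸ List.get_mem _ b)
      subst hij
      rw [(hnd i).get_inj_iff.1 h])
    (fun x => hH _) (fun u v h => h.symm) (by
      rintro i ⟨a, ha⟩ ⟨b, hb⟩ (hab : a + 1 = b)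
      subst hab
      have := List.isChain_iff_getElem.1 (hch i) a hb
      exact ⟨colourGraph_adj_le this, this⟩)
  refine ⟨F, h1, h2, ?_, h4, by simpa using h5⟩
  rintro ⟨e, he⟩ heF
  induction e with
  | h u v =>
    have := h3 u v heF
    rw [colourGraph, SimpleGraph.fromEdgeSet_adj] at this
    exact this.1.2

set_option maxHeartbeats 1000000 in
/-- Bounds that are uniform over all parameters `α, ε ≥ 1 / k` and `r ≤ k`. -/
theorem exists_uniform_bounds (k : ℕ) (hk : 0 < k) :
    ∃ (T : ℕ) (γ₀ : ℝ) (n₀ : ℕ), 0 < γ₀ ∧ ∀ (r : ℕ) (α ε γ p : ℝ), 1 ≤ r → r ≤ k → α ≤ 1 →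
      ε ≤ 1 → 1 ≤ k * α → 1 ≤ k * ε → 0 ≤ γ → γ ≤ γ₀ → 0 < p →
      ∀ (V : Type*) [Fintype V] (G : SimpleGraph V), n₀ ≤ Fintype.card V →
        IsPseudorandom G γ p →
      ∀ H : G.Subgraph, H.IsSpanning → IsResidual α H →
      ∀ c : H.edgeSet → Fin r,
        ∃ F : G.Subgraph, F ≤ H ∧ IsLinearForest F.coe ∧
          (∃ k : Fin r, ∀ e : H.edgeSet, e.1 ∈ F.edgeSet → c e = k) ∧
          (1 - ε) * min (2 * α * (Fintype.card V : ℝ) / (r : ℝ))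
              (2 * (Fintype.card V : ℝ) / ((r : ℝ) + 1)) ≤ (F.edgeSet.ncard : ℝ) ∧
          Nat.card F.coe.ConnectedComponent ≤ T := by
  have hk0 : (0 : ℝ) < k := by exact_mod_cast hk
  have hk1 : (1 : ℝ) ≤ k := by exact_mod_cast hk
  -- Gives `(2r + 2) σ ≤ 1 / (4k²) ≤ εα / 4`. Below, `c = 1 / (2k²)` works as `M ≥ m / 2 ≥ n /
  -- (2k²)`, and `κ = 1 / (16k)` makes `8κ ≤ ε / 2`.
  set σ : ℝ := 1 / (16 * k ^ 3) with hσ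
  have hσ0 : 0 < σ := by positivity
  obtain ⟨T, γ₀, n₀, hγ₀, h⟩ := exists_cover_or_paths (c := 1 / (2 * k ^ 2)) (κ := 1 / (16 * k))
    (η := σ ^ 2) (by positivity) (by positivity)
    (by rw [div_le_one (by positivity)]; linarith) (by positivity)
  obtain ⟨n₁, hn₁⟩ := exists_nat_ge (200 / σ)
  refine ⟨T, min γ₀ (σ / 200), max 1 (max n₀ n₁), by positivity, ?_⟩
  intro r α ε γ p hr hrk hα1 hε1 hα hε hγ0 hγ hp V _ G hn hG H hH hres c
  have hα0 : 0 < α := by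
    by_contra! h
    nlinarith
  have hε0 : 0 < ε := by
    by_contra! h
    nlinarith
  have hr1 : (1 : ℝ) ≤ r := by exact_mod_cast hr
  have hrk' : (r : ℝ) ≤ k := by exact_mod_cast hrk
  have hn0 : (0 : ℝ) < Fintype.card V := by
    have : 0 < Fintype.card V := lt_of_lt_of_le one_pos ((le_max_left _ _).trans hn)
    exact_mod_cast this
  set n : ℝ := (Fintype.card V : ℝ) with hndef
  set m : ℝ := min (2 * α * n / r) (2 * n / (r + 1)) with hm
  have hm1 : m * r ≤ 2 * α * n := by
    rw [← le_div_iff₀ (by linarith)]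
    exact min_le_left _ _
  have hm2 : m * (r + 1) ≤ 2 * n := by
    rw [← le_div_iff₀ (by linarith)]
    exact min_le_right _ _
  have hmn : m ≤ n := by nlinarith
  have hml : n / k ^ 2 ≤ m := by
    refine le_min ?_ ?_
    · rw [div_le_div_iff₀ (by positivity) (by linarith)]
      have h1 : (r : ℝ) * 1 ≤ k * (k * α) := mul_le_mul hrk' hα zero_le_one hk0.le
      nlinarith
    · rw [div_le_div_iff₀ (by positivity) (by linarith)]
      have h1 : (r : ℝ) + 1 ≤ 2 * k ^ 2 := by nlinarith
      nlinarith
  have hm0 : 0 < m := lt_of_lt_of_le (by positivity) hml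
  -- Half of `ε` is spent here and half on the loss in the paths: `(1 - ε/2)² ≥ 1 - ε`.
  set M := (1 - ε / 2) * m with hM
  have hMl : 1 / (2 * (k : ℝ) ^ 2) * n ≤ M := by
    calc 1 / (2 * (k : ℝ) ^ 2) * n = 1 / 2 * (n / k ^ 2) := by ring
      _ ≤ 1 / 2 * m := by gcongr
      _ ≤ _ := by
        rw [hM]
        gcongr
        linarith
  have hMn : M ≤ n := by nlinarith
  have hall : ∃ i, ∃ T' ≤ T, ∃ l : Fin T' → List V, (∀ j, (l j).Nodup) ∧
      (∀ j, (l j).IsChain (colourGraph c i).Adj) ∧ (∀ i j, i ≠ j → ∀ v ∈ l i, v ∉ l j) ∧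
      (1 - 8 * (1 / (16 * (k : ℝ)))) * M ≤ ∑ j, (((l j).length - 1 : ℕ) : ℝ) := by
    by_contra hno
    push Not at hno
    refine not_covers_of_isPseudorandom (H := H.spanningCoe) (α := α) (ε := ε) (σ := σ) (M := M)
      (by omega) (hn₁.trans (Nat.cast_le.2 ((le_max_right _ _).trans
        ((le_max_right _ _).trans hn)))) hε0 hα0 hα1 hσ0 ?_ ?_ hp hγ0
      (hγ.trans (min_le_right _ _)) hG (fun i => colourGraph c i) (H.spanningCoe_le) ?_ ?_ ?_ ?_
      fun i => ?_
    · rw [hσ, div_le_one (by positivity)]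
      have : (1 : ℝ) ≤ k ^ 3 := one_le_pow₀ hk1
      linarith
    · have h1 : (1 : ℝ) ≤ k ^ 2 * (ε * α) := by
        calc (1 : ℝ) = 1 * 1 := by ring
          _ ≤ (k * ε) * (k * α) := mul_le_mul hε hα zero_le_one (by positivity)
          _ = _ := by ring
      have h2 : (2 * (r : ℝ) + 2) * σ ≤ (4 * k) * σ := by
        gcongr
        linarith
      have h3 : (4 * (k : ℝ)) * σ = 1 / 4 * (1 / k ^ 2) := by
        rw [hσ]
        field_simp
        norm_num
      have h4 : 1 / (k : ℝ) ^ 2 ≤ ε * α := by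
        rw [div_le_iff₀ (by positivity)]
        linarith
      nlinarith [mul_pos hε0 hα0]
    · intro u v huv
      exact ⟨c ⟨s(u, v), huv⟩, (SimpleGraph.fromEdgeSet_adj _).2 ⟨⟨huv, rfl⟩, huv.ne⟩⟩
    · intro v
      have h1 := hres v (hH v)
      rw [hH.verts_eq_univ, Set.inter_univ] at h1
      rw [edgeCount_singleton_univ, edgeCount_singleton_univ]
      exact h1
    · rw [hM]
      nlinarith
    · rw [hM]
      nlinarith
    · rcases h V G (colourGraph c i) γ p M hp (hγ.trans (min_le_left _ _)) hG
        ((le_max_left _ _).trans ((le_max_right _ _).trans hn))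
        (fun u v huv => (colourGraph_adj_le huv).adj_sub) hMl hMn with h1 | h1
      · exact h1
      · obtain ⟨T', hT', l, h1, h2, h3, h4⟩ := h1
        exact absurd h4 (not_le.2 (hno i T' hT' l h1 h2 h3))
  obtain ⟨i, T', hT', l, hnd, hch, hdis, hlen⟩ := hall
  obtain ⟨F, h1, h2, h3, h4, h5⟩ := exists_linearForest_of_lists hH c i l hnd hch hdis
  refine ⟨F, h1, h2, ⟨i, h3⟩, ?_, h5.trans hT'⟩
  have h6 : ∑ j, (((l j).length - 1 : ℕ) : ℝ) ≤ F.edgeSet.ncard := by exact_mod_cast h4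
  refine le_trans ?_ (hlen.trans h6)
  have h7 : 8 * (1 / (16 * (k : ℝ))) ≤ ε / 2 := by
    rw [mul_one_div, div_le_iff₀ (by positivity)]
    linarith
  calc (1 - ε) * m ≤ (1 - ε / 2) * ((1 - ε / 2) * m) := by nlinarith [mul_pos hm0 (pow_pos hε0 2)]
    _ ≤ _ := by
      have hM0 : 0 ≤ M := le_trans (by positivity) hMl
      gcongr

theorem exists_antitone_bound (f : ℕ → ℝ) (hf : ∀ k, 0 < f k) :
    ∃ h : ℕ → ℝ, Antitone h ∧ (∀ k, 0 < h k) ∧ (∀ k, h k ≤ 1) ∧ ∀ k, h k ≤ f k := by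
  have h0 : ∀ j, 0 < min 1 (f j) := fun j => lt_min one_pos (hf j)
  have hpos : ∀ k, 0 < ∏ j ∈ Finset.range k, min 1 (f j) := fun k =>
    Finset.prod_pos fun j _ => h0 j
  have hle : ∀ k, ∏ j ∈ Finset.range k, min 1 (f j) ≤ 1 := fun k =>
    Finset.prod_le_one (fun j _ => (h0 j).le) fun j _ => min_le_left _ _
  refine ⟨fun k => ∏ j ∈ Finset.range (k + 1), min 1 (f j), antitone_nat_of_succ_le fun k => ?_,
    fun k => hpos _, fun k => hle _, fun k => ?_⟩
  · rw [Finset.prod_range_succ _ (k + 1)]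
    exact mul_le_of_le_one_right (hpos _).le (min_le_left _ _)
  · beta_reduce
    rw [Finset.prod_range_succ]
    exact (mul_le_of_le_one_left (h0 k).le (hle k)).trans (min_le_right _ _)

/-- The sum of ceilings is one integer dominating all inverse parameters, which reduces monotone
dependence on three reals to an antitone sequence. -/
theorem isHierarchyBound_comp_ceil {h : ℕ → ℝ} (hh : Antitone h) (h0 : ∀ k, 0 < h k)
    (h1 : ∀ k, h k ≤ 1) :
    IsHierarchyBound fun x : Fin 3 → ℝ => h (⌈1 / x 0⌉₊ + ⌈1 / x 1⌉₊ + ⌈1 / x 2⌉₊) := by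
  refine ⟨fun x hx y _ hxy => hh ?_, fun x _ => ⟨h0 _, h1 _⟩⟩
  have key : ∀ i, ⌈1 / y i⌉₊ ≤ ⌈1 / x i⌉₊ := fun i =>
    Nat.ceil_mono (one_div_le_one_div_of_le (hx i).1 (hxy i))
  exact add_le_add (add_le_add (key 0) (key 1)) (key 2)

end Main

theorem mainTheorem7 :
    ∃ g₁ g₂ : (Fin 3 → ℝ) → ℝ, ∃ g₃ : (Fin 2 → ℝ) → ℝ,
      IsHierarchyBound g₁ ∧ IsHierarchyBound g₂ ∧ IsHierarchyBound g₃ ∧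
      ∀ (r : ℕ) (α ε : ℝ), 1 ≤ r → α ∈ Set.Ioc (0 : ℝ) 1 → ε ∈ Set.Ioc (0 : ℝ) 1 →
      ∀ C γ : ℝ, 0 < C → 1 / C ≤ g₁ ![α, ε, 1 / (r : ℝ)] →
        0 < γ → γ ≤ g₂ ![α, ε, 1 / (r : ℝ)] →
      ∀ n : ℕ, 0 < n → 1 / (n : ℝ) ≤ g₃ ![1 / C, γ] →
      ∀ p ∈ Set.Ioc (0 : ℝ) 1,
      ∀ (V : Type*) [Fintype V] (G : SimpleGraph V), Fintype.card V = n →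
        IsPseudorandom G γ p →
      ∀ H : G.Subgraph, H.IsSpanning → IsResidual α H →
      ∀ c : H.edgeSet → Fin r,
        ∃ F : G.Subgraph, F ≤ H ∧ IsLinearForest F.coe ∧
          (∃ k : Fin r, ∀ e : H.edgeSet, e.1 ∈ F.edgeSet → c e = k) ∧
          (1 - ε) * min (2 * α * (n : ℝ) / (r : ℝ)) (2 * (n : ℝ) / ((r : ℝ) + 1)) ≤
            (F.edgeSet.ncard : ℝ) ∧
          (Nat.card F.coe.ConnectedComponent : ℝ) ≤ C := by
  choose T γ₀ n₀ hγ₀ hmain using fun k : ℕ => exists_uniform_bounds (k + 1) k.succ_pos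
  obtain ⟨h, hanti, hpos, hone, hle⟩ := exists_antitone_bound
    (fun k => min (γ₀ k) (min (1 / ((T k : ℝ) + 1)) (1 / ((n₀ k : ℝ) + 1))))
    (fun k => lt_min (hγ₀ k) (lt_min (by positivity) (by positivity)))
  have hb := isHierarchyBound_comp_ceil hanti hpos hone
  -- `g₃` cannot see `α, ε, r`, but `1 / n ≤ γ` suffices because `g₂` already keeps `γ` below `1 /
  -- (n₀ k + 1)`.
  refine ⟨_, _, fun y => y 1, hb, hb, ⟨fun x _ y _ hxy => hxy 1, fun x hx => hx 1⟩, ?_⟩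
  intro r α ε hr hα hε C γ hC hCg hγ hγg n hn hng p hp V _ G hVn hG H hH hres c
  simp only [Matrix.cons_val_zero, Matrix.cons_val_one, Matrix.cons_val] at hCg hγg hng
  set k := ⌈1 / α⌉₊ + ⌈1 / ε⌉₊ + ⌈1 / (1 / (r : ℝ))⌉₊ with hk
  have hr0 : (0 : ℝ) < r := by exact_mod_cast hr
  have hk1 : ⌈1 / α⌉₊ ≤ k + 1 := by omega
  have hk2 : ⌈1 / ε⌉₊ ≤ k + 1 := by omega
  have hk3 : ⌈1 / (1 / (r : ℝ))⌉₊ ≤ k + 1 := by omega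
  rw [one_div_one_div, Nat.ceil_natCast] at hk3
  have hkα : 1 ≤ ((k + 1 : ℕ) : ℝ) * α := by
    rw [← div_le_iff₀ hα.1]
    exact Nat.ceil_le.1 hk1
  have hkε : 1 ≤ ((k + 1 : ℕ) : ℝ) * ε := by
    rw [← div_le_iff₀ hε.1]
    exact Nat.ceil_le.1 hk2
  have hkγ : h k ≤ γ₀ k := (hle k).trans (min_le_left _ _)
  have hkT : h k ≤ 1 / ((T k : ℝ) + 1) :=
    (hle k).trans ((min_le_right _ _).trans (min_le_left _ _))
  have hkn : h k ≤ 1 / ((n₀ k : ℝ) + 1) :=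
    (hle k).trans ((min_le_right _ _).trans (min_le_right _ _))
  have hn' : (0 : ℝ) < n := by exact_mod_cast hn
  have hTC : (T k : ℝ) + 1 ≤ C :=
    (one_div_le_one_div hC (by positivity)).1 (hCg.trans hkT)
  have hnn : (n₀ k : ℝ) + 1 ≤ n :=
    (one_div_le_one_div hn' (by positivity)).1 ((hng.trans hγg).trans hkn)
  have hnn' : n₀ k ≤ Fintype.card V := by
    rw [hVn]
    have : (n₀ k : ℝ) ≤ n := by linarith
    exact_mod_cast this
  obtain ⟨F, h1, h2, h3, h4, h5⟩ := hmain k r α ε γ p hr hk3 hα.2 hε.2 hkα hkε hγ.le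
    (hγg.trans hkγ) hp.1 V G hnn' hG H hH hres c
  rw [hVn] at h4
  refine ⟨F, h1, h2, h3, h4, ?_⟩
  have : (Nat.card F.coe.ConnectedComponent : ℝ) ≤ T k := by exact_mod_cast h5
  linarith
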